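/- Let $K$ be a field, let $R\subseteq A$ be $K$-algebras, and let $A=\sigma(R)\langle x_1,\dots,x_n\rangle$ be a bijective skew PBW extension of $R$. That is: $A$ is a free left $R$-module with basis the standard monomials $x^\alpha=x_1^{\alpha_1}\cdots x_n^{\alpha_n}$, $\alpha\in\mathbb N^n$; for all $i$ and all $r\in R\setminus\{0\}$ there is $c_{i,r}\in R\setminus\{0\}$ with $x_ir-c_{i,r}x_i\in R$; for all $i,j$ there are $c_{ij}\in R\setminus\{0\}$ and $a_{ij}^{(k)},d_{ij}\in R$ with $$x_jx_i=c_{ij}x_ix_j+a_{ij}^{(1)}x_1+\cdots+a_{ij}^{(n)}x_n+d_{ij};$$ and, writing $x_ir=\sigma_i(r)x_i+\delta_i(r)$ with $\sigma_i(r),\delta_i(r)\in R$, every $\sigma_i$ is bijective and every $c_{ij}$ with $i<j$ is invertible. A semi-graduation of a ring $B$ is a family $\{B_p\}_{p\ge 0}$ of additive subgroups with $B=\bigoplus_p B_p$, $B_pB_q\subseteq B_0\oplus\cdots\oplus B_{p+q}$ and $1\in B_0$. The ring $B$ is finitely semi-graded (FSG) if, moreover, $B$ is generated as a ring by $B_0$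 and finitely many elements and every $B_p$ is a free left $B_0$-module of finite rank; if $B$ is a $K$-algebra, it is connected if $B_0=K$. Let $B_{\ge 1}$ be the least two-sided ideal $I$ of $B$ that contains $\bigoplus_{p\ge1}B_p$ and satisfies $I=\bigoplus_p (I\cap B_p)$. A $K$-algebra $B$ is left semi-graded Artin–Schelter regular if it has a semi-graduation for which it is FSG and connected, $\mathrm{lgld}(B)=d<\infty$, $\mathrm{Ext}^i_B({}_B(B/B_{\ge1}),{}_BB)=0$ for $i\ne d$, and $\mathrm{Ext}^d_B({}_B(B/B_{\ge1}),{}_BB)\cong (B/B_{\ge1})_B$ as right $B$-modules. Assume that $\mathrm{lgld}(R)<\infty$; that $R$ is FSG with semi-graduation $R=\bigoplus_{p\ge0}R_p$ and is connected, $R_0=K$; that $\sigma_i(R_p)\subseteq R_p$ and $\delta_i(R_p)\subseteq R_p$ for all $i$ and $p$; and that $d_{ij}\in K\setminus\{0\}$ for some $i,j$. Then $A$ is a left semi-graded Artin–Schelter regular algebra. Moreover, if the subgroups $A_p$ of $A$ generated by the products $r\,x^\alpha$ with $r\in R_q$, $q+\alpha_1+\cdots+\alpha_n=p$, form a semi-graduation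 of $A$, then $A$ is left semi-graded Artin–Schelter regular with respect to that semi-graduation. -/

import Mathlib

open CategoryTheory

universe u

noncomputable section

/-! ### Skew PBW extensions -/

/-- The standard monomial `x^α = x_1^{α_1} ⋯ x_n^{α_n}` (product in increasing order). -/
def stdMonomial {A : Type*} [Ring A] {n : ℕ} (x : Fin n → A) (α : Fin n → ℕ) : A :=
  (List.ofFn fun i => x i ^ α i).prod

/-- The relation `x_j x_i = c x_i x_j + a_1 x_1 + ⋯ + a_n x_n + d` with `c, a_k, d ∈ R`. -/
def CommRel {R A : Type*} [Ring R] [Ring A] (ι : R →+* A) {n : ℕ} (x : Fin n → A)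
    (i j : Fin n) (c : R) (a : Fin n → R) (d : R) : Prop :=
  x j * x i = ι c * x i * x j + ∑ k, ι (a k) * x k + ι d

/-- `A = σ(R)⟨x_1, …, x_n⟩` is a skew PBW extension of `R`, where `R` is regarded as a subring
of `A` through the injective ring homomorphism `ι`. -/
structure IsSkewPBW {R A : Type*} [Ring R] [Ring A] (ι : R →+* A) {n : ℕ} (x : Fin n → A) :
    Prop where
  injective : Function.Injective ι
  /-- `A` is a free left `R`-module with basis the standard monomials. -/
  free : ∀ z : A, ∃! f : (Fin n → ℕ) →₀ R, (f.sum fun α r => ι r * stdMonomial x α) = z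
  comm_coeff : ∀ (i : Fin n) (r : R), r ≠ 0 →
    ∃ c : R, c ≠ 0 ∧ x i * ι r - ι c * x i ∈ ι.range
  comm_var : ∀ i j : Fin n, ∃ c : R, c ≠ 0 ∧ ∃ (a : Fin n → R) (d : R), CommRel ι x i j c a d

namespace IsSkewPBW

variable {R A : Type*} [Ring R] [Ring A] {ι : R →+* A} {n : ℕ} {x : Fin n → A}

/-- The coefficients of `z` in the basis of standard monomials. -/
def coeff (h : IsSkewPBW ι x) (z : A) : (Fin n → ℕ) →₀ R := (h.free z).choose

/-- `σ_i(r)` is the coefficient of `x_i` in `x_i r`. -/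
def sigma (h : IsSkewPBW ι x) (i : Fin n) (r : R) : R := h.coeff (x i * ι r) (Pi.single i 1)

/-- `δ_i(r)` is the constant coefficient of `x_i r`. -/
def delta (h : IsSkewPBW ι x) (i : Fin n) (r : R) : R := h.coeff (x i * ι r) 0

theorem stdMonomial_single (x : Fin n → A) (i : Fin n) : stdMonomial x (Pi.single i 1) = x i := by
  unfold stdMonomial
  induction n with
  | zero => exact i.elim0
  | succ n ih =>
    rw [List.ofFn_succ, List.prod_cons]
    refine Fin.cases ?_ (fun j => ?_) i
    · have : (List.ofFn fun k : Fin n => x k.succ ^ (Pi.single (0 : Fin (n + 1)) 1 :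
          Fin (n + 1) → ℕ) k.succ) = List.ofFn fun _ : Fin n => (1 : A) := by
        congr 1; funext k; simp
      rw [this]; simp
    · have := ih (fun k => x k.succ) j
      rw [← this]
      simp [Pi.single_apply, Fin.succ_inj, eq_comm]

theorem stdMonomial_zero (x : Fin n → A) : stdMonomial x 0 = 1 := by
  simp [stdMonomial]

/-- The defining identity `x_i r = σ_i(r) x_i + δ_i(r)` of `σ_i` and `δ_i`. -/
theorem mul_eq (h : IsSkewPBW ι x) (i : Fin n) (r : R) :
    x i * ι r = ι (h.sigma i r) * x i + ι (h.delta i r) := by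
  obtain ⟨c, d, hcd⟩ : ∃ c d : R, x i * ι r = ι c * x i + ι d := by
    by_cases hr : r = 0
    · exact ⟨0, 0, by simp [hr]⟩
    · obtain ⟨c, -, d, hd⟩ := h.comm_coeff i r hr
      exact ⟨c, d, by rw [hd]; abel⟩
  have hne : (Pi.single i 1 : Fin n → ℕ) ≠ 0 := by
    intro h0
    simpa using congrFun h0 i
  have hf : h.coeff (x i * ι r) =
      Finsupp.single (Pi.single i 1) c + Finsupp.single 0 d := by
    refine ((h.free (x i * ι r)).choose_spec.2 _ ?_).symm
    change ((Finsupp.single (Pi.single i 1) c + Finsupp.single 0 d :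
      (Fin n → ℕ) →₀ R).sum fun α r => ι r * stdMonomial x α) = x i * ι r
    rw [Finsupp.sum_add_index' (by simp) (by intros; simp [add_mul]),
      Finsupp.sum_single_index (by simp), Finsupp.sum_single_index (by simp),
      stdMonomial_single, stdMonomial_zero, hcd, mul_one]
  have hs : h.sigma i r = c := by
    simp [sigma, hf, hne]
  have hd : h.delta i r = d := by
    simp [delta, hf, hne]
  rw [hs, hd, hcd]

/-- The extension is bijective: every `σ_i` is bijective and every `c_{ij}`, `i < j`, is
invertible (`c_{ij}` is the unique `c` for which the relation can hold). -/
def IsBijective (h : IsSkewPBW ι x) : Prop :=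
  (∀ i, Function.Bijective (h.sigma i)) ∧
    ∀ i j : Fin n, i < j → ∃ (c : R) (a : Fin n → R) (d : R), IsUnit c ∧ CommRel ι x i j c a d

end IsSkewPBW

/-! ### Semi-graded rings -/

/-- The family `𝓑` of additive subgroups is a semi-graduation of the ring `B`. -/
structure IsSemiGraduation {B : Type*} [Ring B] (𝓑 : ℕ → AddSubgroup B) : Prop where
  internal : DirectSum.IsInternal 𝓑
  mul_mem : ∀ m n : ℕ, ∀ a ∈ 𝓑 m, ∀ b ∈ 𝓑 n, a * b ∈ ⨆ k ∈ Set.Iic (m + n), 𝓑 k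
  one_mem : (1 : B) ∈ 𝓑 0

/-- The subring `B_0` of a semi-graded ring. -/
def IsSemiGraduation.zeroSubring {B : Type*} [Ring B] {𝓑 : ℕ → AddSubgroup B}
    (h : IsSemiGraduation 𝓑) : Subring B :=
  { 𝓑 0 with
    one_mem' := h.one_mem
    mul_mem' := by
      intro a b ha hb
      have := h.mul_mem 0 0 a ha b hb
      simpa using this }

/-- `B` is finitely semi-graded (FSG) with semi-graduation `𝓑`: it is generated as a ring by
`B_0` and finitely many elements, and every `B_n` is a free left `B_0`-module of finite rank. -/
structure IsFSG {B : Type*} [Ring B] (𝓑 : ℕ → AddSubgroup B) : Prop where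
  semi : IsSemiGraduation 𝓑
  fg : ∃ s : Finset B, Subring.closure ((𝓑 0 : Set B) ∪ (s : Set B)) = ⊤
  free : ∀ n : ℕ, ∃ N : Submodule semi.zeroSubring B, N.toAddSubgroup = 𝓑 n ∧
    Module.Free semi.zeroSubring N ∧ Module.Finite semi.zeroSubring N

/-- A semi-graduation of a `K`-algebra is connected if `B_0 = K`. -/
def IsConnectedSG (K : Type*) {B : Type*} [Field K] [Ring B] [Algebra K B]
    (𝓑 : ℕ → AddSubgroup B) : Prop :=
  Function.Injective (algebraMap K B) ∧ (𝓑 0 : Set B) = Set.range (algebraMap K B)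

/-- The two-sided ideal `I` is semi-graded as a left ideal, i.e. `I = ⊕ (I ∩ B_n)`. -/
def IsSemiGradedIdeal {B : Type*} [Ring B] (𝓑 : ℕ → AddSubgroup B) (I : TwoSidedIdeal B) : Prop :=
  ∀ z ∈ I, ∃ f : ℕ →₀ B, (∀ n, f n ∈ 𝓑 n ∧ f n ∈ I) ∧ (f.sum fun _ b => b) = z

/-- `B_{≥ s}`: the least two-sided ideal of `B` that contains `⊕_{p ≥ s} B_p` and is semi-graded
as a left ideal. -/
def geIdeal {B : Type*} [Ring B] (𝓑 : ℕ → AddSubgroup B) (s : ℕ) : TwoSidedIdeal B :=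
  sInf {I | (∀ p, s ≤ p → ∀ b ∈ 𝓑 p, b ∈ I) ∧ IsSemiGradedIdeal 𝓑 I}

/-! ### Homological notions -/

/-- The left global dimension of `B`: the supremum of the projective dimensions of all left
`B`-modules. -/
def lgld (B : Type u) [Ring B] : WithBot ℕ∞ :=
  ⨆ M : ModuleCat.{u} B, projectiveDimension M

/-- The right action of `b : B` on `Ext^i_B(M, B)`, induced by the endomorphism `z ↦ z b` of the
left `B`-module `B`. -/
def extRightMul {B : Type u} [Ring B] {M : ModuleCat.{u} B} {i : ℕ}
    (e : Abelian.Ext.{u} M (ModuleCat.of B B) i) (b : B) :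
    Abelian.Ext.{u} M (ModuleCat.of B B) i :=
  e.comp (Abelian.Ext.mk₀ (ModuleCat.ofHom (LinearMap.toSpanSingleton B B b))) (add_zero i)

/-- The `K`-algebra `B` with the semi-graduation `𝓑` is left semi-graded Artin–Schelter regular:
it is FSG and connected, `lgld(B) = d < ∞`, and `Ext^i_B(B/B_{≥1}, B)` is zero for `i ≠ d` and
isomorphic to `B/B_{≥1}` as a right `B`-module for `i = d`. -/
def IsSASWith (K : Type*) (B : Type u) [Field K] [Ring B] [Algebra K B]
    (𝓑 : ℕ → AddSubgroup B) : Prop :=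
  IsFSG 𝓑 ∧ IsConnectedSG K 𝓑 ∧ ∃ d : ℕ, lgld B = ((d : ℕ∞) : WithBot ℕ∞) ∧
    (∀ i : ℕ, i ≠ d → Subsingleton (Abelian.Ext.{u}
      (ModuleCat.of B (B ⧸ (geIdeal 𝓑 1).asIdeal)) (ModuleCat.of B B) i)) ∧
    ∃ φ : Abelian.Ext.{u}
      (ModuleCat.of B (B ⧸ (geIdeal 𝓑 1).asIdeal)) (ModuleCat.of B B) d ≃+
        (B ⧸ (geIdeal 𝓑 1).asIdeal),
      ∀ e (b : B), φ (extRightMul e b) = φ e * Ideal.Quotient.mk (geIdeal 𝓑 1).asIdeal b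

/-- `B` is a left semi-graded Artin–Schelter regular `K`-algebra. -/
def IsSAS (K : Type*) (B : Type u) [Field K] [Ring B] [Algebra K B] : Prop :=
  ∃ 𝓑 : ℕ → AddSubgroup B, IsSASWith K B 𝓑

/-- The family `A_p`, spanned by the `r x^α` with `r ∈ R_q` and `q + |α| = p`. -/
def canonicalFamily {R A : Type*} [Ring R] [Ring A] (ι : R →+* A) {n : ℕ} (x : Fin n → A)
    (𝓡 : ℕ → AddSubgroup R) (p : ℕ) : AddSubgroup A :=
  AddSubgroup.closure
    {z | ∃ (q : ℕ) (r : R) (α : Fin n → ℕ), r ∈ 𝓡 q ∧ q + ∑ i, α i = p ∧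
      z = ι r * stdMonomial x α}

end

/-! The constant term `d` makes the Ext conditions trivial. If the variables have degree one, they
lie in `A_{≥1}`, hence so does the unit `d = x_j x_i - c x_i x_j - ∑ a_k x_k`. So `A_{≥1} = A`, the
module `A/A_{≥1}` is zero, and all its Ext groups vanish (`CommRel.one_mem_geIdeal`,
`isSASWith_of_one_mem_geIdeal`). Two things remain: finite left global dimension, and a connected
finite semi-graduation with the variables in degree one.

Global dimension: `pd_A M ≤ n + pd_R M` for every left `A`-module `M`. If `M` is free over `R`, it
has a free resolution of length `n` over `A`, built by an involutive-basis argument. Each generator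
carries a level, and only the variables below that level multiply it freely. The kernel of the
presentation is generated by one element for each generator and each variable not below its level,
and these new generators have strictly larger levels (`IsLeveledBasis.isLeveledBasis_syz`). Once all
levels reach `n`, the presentation is an isomorphism. An Eilenberg swindle extends the bound to
`R`-projective modules, and dimension shifting to all modules.

Semi-graduation: `A` is finitely generated over `K`, so the powers of a finite-dimensional
generating space `V` containing `1` exhaust `A`. Successive complements of `V^p` in `V^(p+1)` form a
semi-graduation, and the first can be chosen to contain the variables (`exists_isFSG`). For the
canonical family, finite-dimensionality of its components is what has to be checked. -/

/-! ### Standard monomials and exponents -/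

section StdMonomial

variable {A : Type*} [Ring A]

theorem stdMonomial_succ {n : ℕ} (x : Fin (n + 1) → A) (α : Fin (n + 1) → ℕ) :
    stdMonomial x α = x 0 ^ α 0 * stdMonomial (fun i => x i.succ) (fun i => α i.succ) := by
  simp [stdMonomial, List.ofFn_succ]

theorem stdMonomial_eq_one {n : ℕ} (x : Fin n → A) {α : Fin n → ℕ} (h : ∀ i, α i = 0) :
    stdMonomial x α = 1 := by
  obtain rfl : α = 0 := funext h
  exact IsSkewPBW.stdMonomial_zero x

/-- No relation of the extension is needed: the factors before position `j` are all `1`, so `x j`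
merges with the power of itself. -/
theorem mul_stdMonomial {n : ℕ} (x : Fin n → A) (j : Fin n) (α : Fin n → ℕ)
    (h : ∀ i, α i ≠ 0 → j ≤ i) : x j * stdMonomial x α = stdMonomial x (α + Pi.single j 1) := by
  induction n with
  | zero => exact j.elim0
  | succ n ih =>
    rw [stdMonomial_succ, stdMonomial_succ]
    induction j using Fin.cases with
    | zero =>
      rw [← mul_assoc, ← pow_succ']
      simp
    | succ j =>
      have h0 : α 0 = 0 := by
        by_contra h0
        exact absurd (h 0 h0) (by simp)
      have := ih (fun i => x i.succ) j (fun i => α i.succ)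
        (fun i hi => Fin.succ_le_succ_iff.mp (h _ hi))
      have hs : (fun i : Fin n => (α + Pi.single j.succ 1 : Fin (n + 1) → ℕ) i.succ) =
          (fun i => α i.succ) + Pi.single j 1 := by
        funext i
        simp [Pi.single_apply, Fin.succ_inj]
      rw [hs, ← this]
      simp [h0]

theorem stdMonomial_mul {n : ℕ} (x : Fin n → A) (j : Fin n) (α : Fin n → ℕ)
    (h : ∀ i, α i ≠ 0 → i ≤ j) : stdMonomial x α * x j = stdMonomial x (α + Pi.single j 1) := by
  induction n with
  | zero => exact j.elim0
  | succ n ih =>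
    rw [stdMonomial_succ, stdMonomial_succ]
    induction j using Fin.cases with
    | zero =>
      have h0 : ∀ i : Fin n, α i.succ = 0 := fun i => by
        by_contra h0
        exact absurd (h _ h0) (by simp)
      rw [stdMonomial_eq_one _ h0, stdMonomial_eq_one _ (by simp [h0])]
      simp [pow_succ]
    | succ j =>
      have := ih (fun i => x i.succ) j (fun i => α i.succ)
        (fun i hi => Fin.succ_le_succ_iff.mp (h _ hi))
      have hs : (fun i : Fin n => (α + Pi.single j.succ 1 : Fin (n + 1) → ℕ) i.succ) =
          (fun i => α i.succ) + Pi.single j 1 := by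
        funext i
        simp [Pi.single_apply, Fin.succ_inj]
      rw [hs, ← this]
      simp [mul_assoc]

end StdMonomial

/-- The exponent `α` involves only variables with index less than `l`. -/
def SuppLT {n : ℕ} (l : ℕ) (α : Fin n → ℕ) : Prop :=
  ∀ i, α i ≠ 0 → (i : ℕ) < l

theorem suppLT_zero {n : ℕ} (l : ℕ) : SuppLT l (0 : Fin n → ℕ) := fun _ hi => (hi rfl).elim

theorem suppLT_add_single {n : ℕ} {l : ℕ} {α : Fin n → ℕ} {j : Fin n} :
    SuppLT l (α + Pi.single j 1) ↔ SuppLT l α ∧ (j : ℕ) < l := by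
  constructor
  · refine fun h => ⟨fun i hi => h i ?_, h j (by simp)⟩
    simp [hi]
  · rintro ⟨h, hj⟩ i hi
    by_cases hij : i = j
    · exact hij ▸ hj
    · exact h i (by simpa [Pi.single_apply, hij] using hi)

theorem sum_add_single {n : ℕ} (α : Fin n → ℕ) (j : Fin n) :
    ∑ i, (α + Pi.single j 1 : Fin n → ℕ) i = ∑ i, α i + 1 := by
  simp [Finset.sum_add_distrib, Pi.single_apply]

theorem sub_single_add_single {n : ℕ} {α : Fin n → ℕ} {j : Fin n} (h : α j ≠ 0) :
    α - Pi.single j 1 + Pi.single j 1 = α := by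
  funext i
  by_cases hij : i = j
  · subst hij
    simp
    omega
  · simp [hij]

theorem exists_eq_add_single_min {n : ℕ} {α : Fin n → ℕ} (h : α ≠ 0) :
    ∃ (j : Fin n) (β : Fin n → ℕ), α = β + Pi.single j 1 ∧ ∀ i, α i ≠ 0 → j ≤ i := by
  obtain ⟨j, hj⟩ := Function.ne_iff.mp h
  let s := Finset.univ.filter fun i => α i ≠ 0
  have hs : s.Nonempty := ⟨j, by simpa [s] using hj⟩
  have hm : α (s.min' hs) ≠ 0 := by
    have := s.min'_mem hs
    simpa [s] using this
  exact ⟨s.min' hs, _, (sub_single_add_single hm).symm,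
    fun i hi => s.min'_le i (by simpa [s] using hi)⟩

/-- An exponent that involves a variable of index at least `l` splits off the largest variable
that it involves. -/
theorem exists_eq_add_single_max {n : ℕ} {l : ℕ} {α : Fin n → ℕ} (h : ¬ SuppLT l α) :
    ∃ (j : Fin n) (β : Fin n → ℕ), l ≤ j ∧ α = β + Pi.single j 1 ∧ SuppLT (j + 1) β := by
  simp only [SuppLT, not_forall, not_lt] at h
  obtain ⟨i, hi, hli⟩ := h
  let s := Finset.univ.filter fun i => α i ≠ 0
  have his : i ∈ s := by simpa [s] using hi
  have hm : α (s.max' ⟨i, his⟩) ≠ 0 := by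
    have := s.max'_mem ⟨i, his⟩
    simpa [s] using this
  refine ⟨s.max' ⟨i, his⟩, _, hli.trans (s.le_max' i his), (sub_single_add_single hm).symm, ?_⟩
  intro k hk
  refine Nat.lt_succ_of_le (s.le_max' k ?_)
  have : α k ≠ 0 := fun h0 => hk (by simp [h0])
  simpa [s] using this

/-! ### Filtration by degree and level -/

/-- The left-module form of the relations of a skew PBW extension, the ring `R` acting on `A`
on the left. -/
structure IsLeftPBW (R : Type*) {A : Type*} [Ring R] [Ring A] [Module R A] {n : ℕ}
    (x : Fin n → A) : Prop where
  linearIndependent : LinearIndependent R (stdMonomial x)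
  span_eq_top : Submodule.span R (Set.range (stdMonomial x)) = ⊤
  mul_smul_one : ∀ (i : Fin n) (r : R), ∃ s t : R, x i * (r • (1 : A)) = s • x i + t • 1
  comm : ∀ i j : Fin n, ∃ (c : R) (a : Fin n → R) (d : R),
    x j * x i = c • (x i * x j) + ∑ k, a k • x k + d • 1

namespace IsLeftPBW

variable {R A : Type*} [Ring R] [Ring A] [Module R A] {n : ℕ} {x : Fin n → A}

/-- The basis of standard monomials. -/
noncomputable def basis (h : IsLeftPBW R x) : Module.Basis (Fin n → ℕ) R A :=
  Module.Basis.mk h.linearIndependent h.span_eq_top.ge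

@[simp] theorem basis_apply (h : IsLeftPBW R x) (α : Fin n → ℕ) :
    h.basis α = stdMonomial x α := by
  simp [basis]

/-- The elements of degree at most `m` whose part of degree `m` involves only the variables of
index less than `l`. -/
def filt (R : Type*) {A : Type*} [Ring R] [Ring A] [Module R A] {n : ℕ} (x : Fin n → A)
    (m l : ℕ) : Submodule R A :=
  Submodule.span R (stdMonomial x '' {α | ∑ i, α i < m ∨ ∑ i, α i = m ∧ SuppLT l α})

theorem stdMonomial_mem_filt {m l : ℕ} {α : Fin n → ℕ}
    (hα : ∑ i, α i < m ∨ ∑ i, α i = m ∧ SuppLT l α) : stdMonomial x α ∈ filt R x m l :=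
  Submodule.subset_span ⟨α, hα, rfl⟩

theorem filt_le_of_lt {m m' : ℕ} (h : m < m') (l l' : ℕ) : filt R x m l ≤ filt R x m' l' :=
  Submodule.span_mono (Set.image_mono fun α hα => by
    rcases hα with hα | hα
    · exact Or.inl (hα.trans h)
    · exact Or.inl (hα.1.trans_lt h))

theorem one_mem_filt (m l : ℕ) : (1 : A) ∈ filt R x m l := by
  rw [← IsSkewPBW.stdMonomial_zero x]
  refine stdMonomial_mem_filt ?_
  rcases Nat.eq_zero_or_pos m with rfl | hm
  · exact Or.inr ⟨by simp, suppLT_zero _⟩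
  · exact Or.inl (by simpa using hm)

theorem var_mem_filt {l : ℕ} {i : Fin n} (h : (i : ℕ) < l) : x i ∈ filt R x 1 l := by
  rw [← IsSkewPBW.stdMonomial_single x i, ← zero_add (Pi.single i 1)]
  exact stdMonomial_mem_filt
    (Or.inr ⟨by simp, suppLT_add_single.mpr ⟨suppLT_zero _, h⟩⟩)

theorem basis_repr_eq_zero (h : IsLeftPBW R x) {m l : ℕ} {a : A} (ha : a ∈ filt R x m l)
    {β : Fin n → ℕ} (hβ : ¬ (∑ i, β i < m ∨ ∑ i, β i = m ∧ SuppLT l β)) :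
    h.basis.repr a β = 0 := by
  have hm : a ∈ Submodule.span R
      (h.basis '' {α | ∑ i, α i < m ∨ ∑ i, α i = m ∧ SuppLT l α}) := by
    simpa [filt] using ha
  rw [Module.Basis.mem_span_image] at hm
  by_contra hne
  exact hβ (hm (Finsupp.mem_support_iff.mpr hne))

/-- `x_i (r m) = σ_i(r) x_i m + δ_i(r) m`. -/
theorem smul_smul_eq (h : IsLeftPBW R x) {N : Type*} [AddCommGroup N] [Module A N] [Module R N]
    [IsScalarTower R A N] (i : Fin n) (r : R) :
    ∃ s t : R, ∀ m : N, x i • r • m = s • x i • m + t • m := by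
  obtain ⟨s, t, hst⟩ := h.mul_smul_one i r
  refine ⟨s, t, fun m => ?_⟩
  have := congrArg (· • m) hst
  simpa [add_smul, mul_smul, smul_assoc] using this

/-- To see that `x_i` maps the `R`-span of `s` into an `R`-submodule, it suffices to check
generators. -/
theorem smul_mem_of_mem_span (h : IsLeftPBW R x) {N : Type*} [AddCommGroup N] [Module A N]
    [Module R N] [IsScalarTower R A N] {i : Fin n} {s : Set N} {Y : Submodule R N}
    (h₁ : s ⊆ Y) (h₂ : ∀ m ∈ s, x i • m ∈ Y) {m : N} (hm : m ∈ Submodule.span R s) :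
    x i • m ∈ Y := by
  suffices hs : m ∈ Y ∧ x i • m ∈ Y from hs.2
  induction hm using Submodule.span_induction with
  | mem m hm => exact ⟨h₁ hm, h₂ m hm⟩
  | zero => simp
  | add a b _ _ ha hb => exact ⟨add_mem ha.1 hb.1, by rw [smul_add]; exact add_mem ha.2 hb.2⟩
  | smul r a _ ha =>
    obtain ⟨p, q, hpq⟩ := h.smul_smul_eq (N := N) i r
    refine ⟨Y.smul_mem _ ha.1, ?_⟩
    rw [hpq]
    exact add_mem (Y.smul_mem _ ha.2) (Y.smul_mem _ ha.1)

variable [IsScalarTower R A A]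

/-- Induction on the degree and, within a degree, on the index `i`. If the smallest variable `x j`
of the monomial has `j < i`, the relation exchanges it with `x i`. Then `x i` meets a monomial of
smaller degree, and `x j` has a smaller index. -/
theorem var_mul_mem_filt (h : IsLeftPBW R x) (m : ℕ) (i : Fin n) {l : ℕ} (hil : (i : ℕ) < l)
    {a : A} (ha : a ∈ filt R x m l) : x i * a ∈ filt R x (m + 1) l := by
  induction m using Nat.strong_induction_on generalizing i l a with
  | _ m ihm =>
  induction hi : (i : ℕ) using Nat.strong_induction_on generalizing i a with
  | _ i' ihi =>
  subst hi
  refine h.smul_mem_of_mem_span ?_ ?_ ha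
  · rintro _ ⟨α, hα, rfl⟩
    refine filt_le_of_lt (Nat.lt_succ_self m) l l (stdMonomial_mem_filt hα)
  rintro _ ⟨α, hα, rfl⟩
  rw [smul_eq_mul]
  -- Below top degree the level imposes no condition, so arbitrary variables `x k`, as they occur in
  -- the linear part of a relation, are harmless.
  have low : ∀ (k : Fin n) (β : Fin n → ℕ), ∑ i, β i < m →
      x k * stdMonomial x β ∈ filt R x (m + 1) l := fun k β hβ =>
    filt_le_of_lt (Nat.succ_lt_succ hβ) n l (ihm _ hβ k k.2
      (stdMonomial_mem_filt (Or.inr ⟨rfl, fun i _ => i.2⟩)))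
  rcases hα with hα | ⟨hα, hαl⟩
  · exact low i α hα
  by_cases h0 : ∀ k, α k ≠ 0 → i ≤ k
  · rw [mul_stdMonomial x i α h0]
    exact stdMonomial_mem_filt (Or.inr ⟨by rw [sum_add_single, hα],
      suppLT_add_single.mpr ⟨hαl, hil⟩⟩)
  have hα0 : α ≠ 0 := by
    rintro rfl
    simp at h0
  obtain ⟨j, β, rfl, hj⟩ := exists_eq_add_single_min hα0
  have hji : j < i := by
    push Not at h0
    obtain ⟨k, hk, hki⟩ := h0
    exact (hj k hk).trans_lt hki
  have hβm : ∑ i, β i + 1 = m := by rw [← hα, sum_add_single]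
  rw [← mul_stdMonomial x j β (fun k hk => hj k (by simp [hk])), ← mul_assoc]
  obtain ⟨c, a, d, hc⟩ := h.comm j i
  rw [hc, add_mul, add_mul, Finset.sum_mul]
  simp only [smul_mul_assoc, one_mul, mul_assoc]
  refine add_mem (add_mem (Submodule.smul_mem _ _ ?_)
    (sum_mem fun k _ => Submodule.smul_mem _ _ (low k β (by omega))))
    (Submodule.smul_mem _ _ (stdMonomial_mem_filt (Or.inl (by omega))))
  refine ihi j hji j ((Fin.lt_def.mp hji).trans hil) ?_ rfl
  rw [← hβm]
  exact ihm _ (by omega) i hil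
    (stdMonomial_mem_filt (Or.inr ⟨rfl, (suppLT_add_single.mp hαl).1⟩))

theorem stdMonomial_mul_mem_filt (h : IsLeftPBW R x) {m l : ℕ} {α : Fin n → ℕ}
    (hα : SuppLT l α) {a : A} (ha : a ∈ filt R x m l) :
    stdMonomial x α * a ∈ filt R x (m + ∑ i, α i) l := by
  induction hk : ∑ i, α i generalizing α with
  | zero =>
    have : ∀ i, α i = 0 := by simpa using hk
    simpa [stdMonomial_eq_one x this] using ha
  | succ k ih =>
    have hα0 : α ≠ 0 := by
      rintro rfl
      simp at hk
    obtain ⟨j, β, rfl, hj⟩ := exists_eq_add_single_min hα0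
    rw [suppLT_add_single] at hα
    rw [← mul_stdMonomial x j β (fun k hk => hj k (by simp [hk])), mul_assoc]
    refine h.var_mul_mem_filt _ j hα.2 (ih hα.1 ?_)
    rw [sum_add_single] at hk
    omega

end IsLeftPBW

/-! ### Leveled bases and their syzygies -/

/-- A unitriangular family in a free module is a basis. -/
theorem bijective_linearCombination_of_unitriangular {R T : Type*} [Ring R] (deg : T → ℕ)
    (v : T → T →₀ R)
    (hv : ∀ t t', deg t ≤ deg t' → v t t' = Finsupp.single t (1 : R) t') :
    Function.Bijective (Finsupp.linearCombination R v) := by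
  constructor
  · rw [injective_iff_map_eq_zero]
    intro f hf
    -- At an index of maximal degree in the support only the diagonal entry contributes.
    by_contra hne
    obtain ⟨t, ht, hmax⟩ :=
      f.support.exists_max_image deg (Finsupp.support_nonempty_iff.mpr hne)
    have := DFunLike.congr_fun hf t
    rw [Finsupp.linearCombination_apply, Finsupp.sum_apply, Finsupp.sum,
      Finset.sum_eq_single t] at this
    · rw [Finsupp.smul_apply, hv t t le_rfl] at this
      simp only [Finsupp.single_eq_same, smul_eq_mul, mul_one, Finsupp.coe_zero,
        Pi.zero_apply] at this
      exact Finsupp.mem_support_iff.mp ht this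
    · intro s hs hst
      rw [Finsupp.smul_apply, hv s t (hmax s hs), Finsupp.single_eq_of_ne hst.symm, smul_zero]
    · exact fun h => (h ht).elim
  · rw [← LinearMap.range_eq_top, eq_top_iff]
    have key : ∀ m, ∀ t, deg t = m → Finsupp.single t (1 : R) ∈
        LinearMap.range (Finsupp.linearCombination R v) := by
      intro m
      induction m using Nat.strong_induction_on with
      | _ m ih =>
      rintro t rfl
      have hvt : v t ∈ LinearMap.range (Finsupp.linearCombination R v) :=
        ⟨Finsupp.single t 1, by simp⟩
      have hw : v t - Finsupp.single t 1 ∈ LinearMap.range (Finsupp.linearCombination R v) := by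
        rw [← Finsupp.sum_single (v t - Finsupp.single t 1)]
        refine sum_mem fun s hs => ?_
        have hlt : deg s < deg t := by
          by_contra hle
          exact Finsupp.mem_support_iff.mp hs (by simp [hv t s (not_lt.mp hle)])
        have := Submodule.smul_mem _ ((v t - Finsupp.single t 1 : T →₀ R) s) (ih _ hlt s rfl)
        rwa [Finsupp.smul_single, smul_eq_mul, mul_one] at this
      simpa using sub_mem hvt hw
    intro f _
    rw [← Finsupp.sum_single f]
    refine sum_mem fun s _ => ?_
    have := Submodule.smul_mem _ (f s) (key _ s rfl)
    rwa [Finsupp.smul_single, smul_eq_mul, mul_one] at this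

/-- A generating family `g` of an `A`-module such that the products `x^α g_b`, with `α` involving
only the variables of index less than `l b`, form an `R`-basis, and such that the other products
`x_j g_b` have a restricted form. -/
structure IsLeveledBasis (R : Type*) {A N B : Type*} [Ring R] [Ring A] [Module R A] {n : ℕ}
    (x : Fin n → A) [AddCommGroup N] [Module R N] [Module A N] (l : B → ℕ) (g : B → N) :
    Prop where
  bijective : Function.Bijective (Finsupp.linearCombination R
    fun t : {t : Σ _ : B, Fin n → ℕ // SuppLT (l t.1) t.2} => stdMonomial x t.1.2 • g t.1.1)
  -- The condition `l b' = j + 1` puts every `x k` with `k > j` outside the level of `b'`, so that a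
  -- further product `x k • x i • g b'` can be rewritten in the same way.
  smul_mem : ∀ (b : B) (j : Fin n), l b ≤ j → x j • g b ∈ Submodule.span R
    ({y | ∃ (i : Fin n) (b' : B), i < j ∧ l b' = j + 1 ∧ y = x i • g b'} ∪ Set.range g)

namespace IsLeveledBasis

variable {R A N B : Type*} [Ring R] [Ring A] [Module R A] {n : ℕ} {x : Fin n → A}
  [AddCommGroup N] [Module R N] [Module A N] {l : B → ℕ} {g : B → N}

/-- The presentation `A^(B) → N`. -/
noncomputable abbrev pres (A : Type*) {N B : Type*} [Ring A] [AddCommGroup N] [Module A N]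
    (g : B → N) : (B →₀ A) →ₗ[A] N :=
  Finsupp.linearCombination A g

/-- Index set of the generators of the kernel of the presentation. -/
abbrev SyzIdx (n : ℕ) {B : Type*} (l : B → ℕ) : Type _ := Σ b : B, {j : Fin n // l b ≤ j}

/-- The level of a generator of the kernel. -/
def syzLevel (n : ℕ) {B : Type*} (l : B → ℕ) (b : SyzIdx n l) : ℕ := b.2.1 + 1

/-- The leading monomial of the multiple by a monomial of a generator of the kernel. -/
def lead (n : ℕ) {B : Type*} (l : B → ℕ)
    (t : {t : Σ _ : SyzIdx n l, Fin n → ℕ // SuppLT (syzLevel n l t.1) t.2}) :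
    Σ _ : B, Fin n → ℕ :=
  ⟨t.1.1.1, t.1.2 + Pi.single t.1.1.2.1 1⟩

theorem lead_not_suppLT
    (t : {t : Σ _ : SyzIdx n l, Fin n → ℕ // SuppLT (syzLevel n l t.1) t.2}) :
    ¬ SuppLT (l (lead n l t).1) (lead n l t).2 := by
  intro h
  exact absurd (suppLT_add_single.mp h).2 (not_lt.mpr t.1.1.2.2)

/-- The variable `j` of the generator can be read off as the largest variable of the leading
exponent, because `α` involves only variables of index at most `j`. -/
theorem lead_injective : Function.Injective (lead n l) := by
  rintro ⟨⟨⟨b, j, hj⟩, α⟩, hα⟩ ⟨⟨⟨b', j', hj'⟩, α'⟩, hα'⟩ h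
  simp only [lead, Sigma.mk.injEq] at h
  obtain ⟨rfl, h⟩ := h
  have h := eq_of_heq h
  have aux : ∀ {p q : Fin n} {β γ : Fin n → ℕ}, SuppLT (q + 1) γ →
      β + Pi.single p 1 = γ + Pi.single q 1 → p ≤ q := by
    intro p q β γ hγ he
    by_contra hlt
    have := congrFun he p
    have hpq : p ≠ q := fun h => hlt h.le
    simp only [Pi.add_apply, Pi.single_eq_same, Pi.single_eq_of_ne hpq] at this
    have := hγ p (by omega)
    exact hlt (Fin.le_def.mpr (by omega))
  obtain rfl : j = j' := le_antisymm (aux hα' h) (aux hα h.symm)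
  obtain rfl := add_right_cancel h
  rfl

theorem exists_lead_eq {t : Σ _ : B, Fin n → ℕ} (ht : ¬ SuppLT (l t.1) t.2) :
    ∃ s, lead n l s = t := by
  obtain ⟨b, α⟩ := t
  obtain ⟨j, β, hj, rfl, hβ⟩ := exists_eq_add_single_max ht
  exact ⟨⟨⟨⟨b, j, hj⟩, β⟩, hβ⟩, rfl⟩

/-- The coefficients at the leading monomials. -/
noncomputable def leadCoeff (h : IsLeftPBW R x) (l : B → ℕ) : (B →₀ A) →ₗ[R]
    ({t : Σ _ : SyzIdx n l, Fin n → ℕ // SuppLT (syzLevel n l t.1) t.2} →₀ R) :=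
  (Finsupp.lcomapDomain (lead n l) lead_injective).comp
    (Finsupp.basis fun _ : B => h.basis).repr.toLinearMap

theorem leadCoeff_apply (h : IsLeftPBW R x) (z : B →₀ A)
    (t : {t : Σ _ : SyzIdx n l, Fin n → ℕ // SuppLT (syzLevel n l t.1) t.2}) :
    leadCoeff h l z t = h.basis.repr (z t.1.1.1) (t.1.2 + Pi.single t.1.1.2.1 1) := by
  simp [leadCoeff, Finsupp.lcomapDomain, lead]

variable [IsScalarTower R A N]

/-- On the kernel of the presentation, the coefficients at the leading monomials determine an
element. -/
theorem eq_zero_of_leadCoeff_eq_zero (h : IsLeftPBW R x) (hg : IsLeveledBasis R x l g)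
    {z : B →₀ A} (hz : pres A g z = 0) (hp : leadCoeff h l z = 0) : z = 0 := by
  -- The monomials of `A^(B)` are of two kinds: leading monomials, and those mapped to the `R`-basis
  -- of `N`. Without the former, the image under the presentation determines all coefficients.
  set q := (Finsupp.basis fun _ : B => h.basis).repr z with hq
  have hsupp : ∀ t, ¬ SuppLT (l t.1) t.2 → q t = 0 := by
    intro t ht
    obtain ⟨s, rfl⟩ := exists_lead_eq ht
    exact DFunLike.congr_fun hp s
  let f : {t : Σ _ : B, Fin n → ℕ // SuppLT (l t.1) t.2} →₀ R :=
    q.comapDomain Subtype.val Subtype.val_injective.injOn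
  have hf : f.mapDomain Subtype.val = q := by
    refine Finsupp.mapDomain_comapDomain _ Subtype.val_injective _ ?_
    intro t ht
    have : SuppLT (l t.1) t.2 := by
      by_contra hn
      exact Finsupp.mem_support_iff.mp ht (hsupp t hn)
    exact ⟨⟨t, this⟩, rfl⟩
  have hz' : Finsupp.linearCombination R
      (fun t : Σ _ : B, Fin n → ℕ => stdMonomial x t.2 • g t.1) q = pres A g z := by
    have := congrArg (fun z => pres A g z)
      ((Finsupp.basis fun _ : B => h.basis).linearCombination_repr z)
    rw [← this, ← hq, Finsupp.linearCombination_apply R, Finsupp.linearCombination_apply R,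
      Finsupp.sum, Finsupp.sum, map_sum]
    refine Finset.sum_congr rfl fun t _ => ?_
    rw [LinearMap.map_smul_of_tower]
    simp
  have hf0 : f = 0 := by
    refine hg.bijective.1 ?_
    rw [map_zero, ← hz, ← hz', ← hf, Finsupp.linearCombination_mapDomain]
    rfl
  have : q = 0 := by rw [← hf, hf0, Finsupp.mapDomain_zero]
  simpa [hq] using this

end IsLeveledBasis

namespace IsLeveledBasis

variable {R A N B : Type*} [Ring R] [Ring A] [Module R A] {n : ℕ} {x : Fin n → A}
  [AddCommGroup N] [Module R N] [Module A N] [IsScalarTower R A N]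
  {l : B → ℕ} {g : B → N}

/-- The lower-order terms that are allowed in `x^α h`, where `h` is a generator of the kernel with
leading term `x_j e_b`, `k = j + 1` and `m = |α|`. -/
def lower (R : Type*) {A B : Type*} [Ring R] [Ring A] [Module R A] {n : ℕ} (x : Fin n → A)
    (l : B → ℕ) (m k : ℕ) : Submodule R (B →₀ A) where
  carrier := {f | ∀ b, f b ∈ IsLeftPBW.filt R x m n ∨
    l b = k ∧ f b ∈ IsLeftPBW.filt R x (m + 1) k}
  zero_mem' := fun b => Or.inl (by simp)
  add_mem' := by
    intro f f' hf hf' b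
    by_cases hb : l b = k
    · have key : ∀ f : B →₀ A, (f b ∈ IsLeftPBW.filt R x m n ∨
          l b = k ∧ f b ∈ IsLeftPBW.filt R x (m + 1) k) →
          f b ∈ IsLeftPBW.filt R x (m + 1) k := fun f hf =>
        hf.elim (fun h => IsLeftPBW.filt_le_of_lt (Nat.lt_succ_self m) _ _ h) And.right
      exact Or.inr ⟨hb, add_mem (key f (hf b)) (key f' (hf' b))⟩
    · exact Or.inl (add_mem ((hf b).resolve_right fun h => hb h.1)
        ((hf' b).resolve_right fun h => hb h.1))
  smul_mem' := fun r f hf b =>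
    (hf b).imp (Submodule.smul_mem _ r) (And.imp_right (Submodule.smul_mem _ r))

theorem single_mem_lower {m k : ℕ} {b : B} {a : A} (ha : a ∈ IsLeftPBW.filt R x m n ∨
    l b = k ∧ a ∈ IsLeftPBW.filt R x (m + 1) k) : Finsupp.single b a ∈ lower R x l m k := by
  classical
  intro b'
  by_cases hb : b = b'
  · subst hb
    simpa using ha
  · simp [Finsupp.single_eq_of_ne (Ne.symm hb)]

/-- Elements of `lower` have no leading monomials in high degree. -/
theorem leadCoeff_eq_zero_of_mem_lower (h : IsLeftPBW R x) {m k : ℕ} {f : B →₀ A}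
    (hf : f ∈ lower R x l m k)
    {t : {t : Σ _ : SyzIdx n l, Fin n → ℕ // SuppLT (syzLevel n l t.1) t.2}}
    (ht : m ≤ ∑ i, t.1.2 i) : leadCoeff h l f t = 0 := by
  rw [leadCoeff_apply]
  rcases hf t.1.1.1 with hb | ⟨hl, hb⟩
  · refine h.basis_repr_eq_zero hb ?_
    rw [sum_add_single]
    omega
  · refine h.basis_repr_eq_zero hb ?_
    rw [sum_add_single]
    rintro (hlt | ⟨-, hs⟩)
    · omega
    -- The allowed part of degree `m + 1` involves only variables below the level of its generator,
    -- whereas a leading monomial always involves another one.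
    · rw [← hl] at hs
      exact lead_not_suppLT t hs

theorem exists_tail (hg : IsLeveledBasis R x l g) (b : B) (j : Fin n) (hj : l b ≤ j) :
    ∃ s ∈ Submodule.span R ({y : B →₀ A | ∃ (i : Fin n) (b' : B), i < j ∧ l b' = j + 1 ∧
      y = x i • Finsupp.single b' 1} ∪ Set.range fun b => Finsupp.single b 1),
      pres A g s = x j • g b := by
  have h := hg.smul_mem b j hj
  suffices hs : Submodule.span R ({y | ∃ (i : Fin n) (b' : B), i < j ∧ l b' = j + 1 ∧
      y = x i • g b'} ∪ Set.range g) ≤ Submodule.map ((pres A g).restrictScalars R)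
      (Submodule.span R ({y : B →₀ A | ∃ (i : Fin n) (b' : B), i < j ∧ l b' = j + 1 ∧
      y = x i • Finsupp.single b' 1} ∪ Set.range fun b => Finsupp.single b 1)) by
    obtain ⟨s, hs, he⟩ := hs h
    exact ⟨s, hs, he⟩
  rw [Submodule.span_le]
  rintro _ (⟨i, b', hi, hb', rfl⟩ | ⟨b', rfl⟩)
  · exact ⟨_, Submodule.subset_span (Or.inl ⟨i, b', hi, hb', rfl⟩), by simp⟩
  · exact ⟨_, Submodule.subset_span (Or.inr ⟨b', rfl⟩), by simp⟩

/-- The part `s` of a generator `x_j e_b - s` of the kernel. -/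
noncomputable def tail (hg : IsLeveledBasis R x l g) (b : SyzIdx n l) : B →₀ A :=
  (hg.exists_tail b.1 b.2.1 b.2.2).choose

theorem tail_mem_span (hg : IsLeveledBasis R x l g) (b : SyzIdx n l) :
    hg.tail b ∈ Submodule.span R ({y : B →₀ A | ∃ (i : Fin n) (b' : B), i < b.2.1 ∧
      l b' = b.2.1 + 1 ∧ y = x i • Finsupp.single b' 1} ∪
      Set.range fun b => Finsupp.single b 1) :=
  (hg.exists_tail b.1 b.2.1 b.2.2).choose_spec.1

theorem pres_tail (hg : IsLeveledBasis R x l g) (b : SyzIdx n l) :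
    pres A g (hg.tail b) = x b.2.1 • g b.1 :=
  (hg.exists_tail b.1 b.2.1 b.2.2).choose_spec.2

theorem tail_mem_lower (hg : IsLeveledBasis R x l g) (b : SyzIdx n l) :
    hg.tail b ∈ lower R x l 0 (syzLevel n l b) := by
  refine Submodule.span_le.mpr ?_ (hg.tail_mem_span b)
  rintro _ (⟨i, b', hi, hb', rfl⟩ | ⟨b', rfl⟩)
  · rw [Finsupp.smul_single, smul_eq_mul, mul_one]
    exact single_mem_lower (Or.inr ⟨hb', IsLeftPBW.var_mem_filt
      ((Fin.lt_def.mp hi).trans (Nat.lt_succ_self _))⟩)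
  · exact single_mem_lower (Or.inl (IsLeftPBW.one_mem_filt _ _))

variable [IsScalarTower R A A]

theorem stdMonomial_smul_mem_lower (h : IsLeftPBW R x) {m k : ℕ} {α : Fin n → ℕ}
    (hα : SuppLT k α) {f : B →₀ A} (hf : f ∈ lower R x l m k) :
    stdMonomial x α • f ∈ lower R x l (m + ∑ i, α i) k := by
  intro b
  rcases hf b with hb | ⟨hl, hb⟩
  · exact Or.inl (h.stdMonomial_mul_mem_filt (fun i _ => i.2) hb)
  · refine Or.inr ⟨hl, ?_⟩
    have := h.stdMonomial_mul_mem_filt hα hb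
    rwa [add_right_comm] at this

theorem var_smul_mem_lower (h : IsLeftPBW R x) {m k : ℕ} {j : Fin n} (hj : (j : ℕ) < k)
    {f : B →₀ A} (hf : f ∈ lower R x l m k) : x j • f ∈ lower R x l (m + 1) k := by
  have := stdMonomial_smul_mem_lower h (α := Pi.single j 1) (k := k)
    (by simpa [hj] using suppLT_add_single.mpr ⟨suppLT_zero k, hj⟩) hf
  simpa [IsSkewPBW.stdMonomial_single] using this

/-- The generators of the kernel of the presentation. -/
noncomputable def syz (hg : IsLeveledBasis R x l g) (b : SyzIdx n l) :
    LinearMap.ker (pres A g) :=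
  ⟨x b.2.1 • Finsupp.single b.1 1 - hg.tail b, by simp [pres_tail]⟩

/-- The product `x^α x_j` is already a standard monomial since `α` involves only variables up to
`x_j`. The multiple of the tail stays in `lower`, hence has no leading monomials in the degrees
considered. -/
theorem leadCoeff_stdMonomial_smul_syz (h : IsLeftPBW R x) (hg : IsLeveledBasis R x l g)
    (t t' : {t : Σ _ : SyzIdx n l, Fin n → ℕ // SuppLT (syzLevel n l t.1) t.2})
    (ht : ∑ i, t.1.2 i ≤ ∑ i, t'.1.2 i) :
    leadCoeff h l (stdMonomial x t.1.2 • (hg.syz t.1.1 : B →₀ A)) t' =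
      Finsupp.single t (1 : R) t' := by
  have hlow : leadCoeff h l (stdMonomial x t.1.2 • hg.tail t.1.1) t' = 0 := by
    refine leadCoeff_eq_zero_of_mem_lower h
      (stdMonomial_smul_mem_lower h t.2 (hg.tail_mem_lower _)) ?_
    simpa using ht
  have hmain : leadCoeff h l (stdMonomial x t.1.2 • x t.1.1.2.1 • Finsupp.single t.1.1.1 1) t' =
      Finsupp.single t (1 : R) t' := by
    have hmul : stdMonomial x t.1.2 * x t.1.1.2.1 = h.basis (t.1.2 + Pi.single t.1.1.2.1 1) := by
      rw [h.basis_apply]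
      exact stdMonomial_mul x _ _ fun i hi => Fin.le_def.mpr (Nat.lt_succ_iff.mp (t.2 i hi))
    have hb : stdMonomial x t.1.2 • x t.1.1.2.1 • Finsupp.single t.1.1.1 (1 : A) =
        (Finsupp.basis fun _ : B => h.basis) (lead n l t) := by
      rw [smul_smul, hmul, Finsupp.smul_single, smul_eq_mul, mul_one]
      simp [lead]
    rw [hb, leadCoeff, LinearMap.comp_apply, LinearEquiv.coe_coe, Module.Basis.repr_self]
    change Finsupp.single (lead n l t) (1 : R) (lead n l t') = _
    exact Finsupp.single_apply_left lead_injective _ _ _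
  rw [syz, smul_sub, map_sub, Finsupp.sub_apply, hlow, hmain, sub_zero]

/-- Taking leading coefficients is injective on the kernel and sends the proposed basis to a
unitriangular family. Bijectivity of the composite then forces bijectivity of the first map. -/
theorem syz_bijective (h : IsLeftPBW R x) (hg : IsLeveledBasis R x l g) :
    Function.Bijective (Finsupp.linearCombination R
      fun t : {t : Σ _ : SyzIdx n l, Fin n → ℕ // SuppLT (syzLevel n l t.1) t.2} =>
        stdMonomial x t.1.2 • hg.syz t.1.1) := by
  let p := (leadCoeff h l).comp ((LinearMap.ker (pres A g)).subtype.restrictScalars R)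
  have hp : Function.Injective p := by
    rw [injective_iff_map_eq_zero]
    intro z hz
    exact Subtype.ext (eq_zero_of_leadCoeff_eq_zero h hg z.2 hz)
  have hb := bijective_linearCombination_of_unitriangular
    (fun t : {t : Σ _ : SyzIdx n l, Fin n → ℕ // SuppLT (syzLevel n l t.1) t.2} =>
      ∑ i, t.1.2 i) (fun t => p (stdMonomial x t.1.2 • hg.syz t.1.1))
    (leadCoeff_stdMonomial_smul_syz h hg)
  have hcomp : Finsupp.linearCombination R (fun t : {t : Σ _ : SyzIdx n l, Fin n → ℕ //
      SuppLT (syzLevel n l t.1) t.2} => p (stdMonomial x t.1.2 • hg.syz t.1.1)) =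
      p.comp (Finsupp.linearCombination R fun t => stdMonomial x t.1.2 • hg.syz t.1.1) := by
    ext t
    simp
  rw [hcomp, LinearMap.coe_comp] at hb
  exact (Function.Bijective.of_comp_iff' ⟨hp, hb.2.of_comp⟩ _).mp hb

/-- Elements of the kernel without terms of degree at least `2` outside the allowed ones are
`R`-combinations of the generators. -/
theorem mem_span_syz_of_mem_lower (h : IsLeftPBW R x) (hg : IsLeveledBasis R x l g) {k : ℕ}
    (z : LinearMap.ker (pres A g)) (hz : (z : B →₀ A) ∈ lower R x l 1 k) :
    z ∈ Submodule.span R (Set.range hg.syz) := by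
  classical
  obtain ⟨f, rfl⟩ := (syz_bijective h hg).2 z
  have hf : ∀ t ∈ f.support, ∑ i, t.1.2 i = 0 := by
    intro t ht
    -- The coefficient at a term of maximal degree equals the leading coefficient there, which
    -- vanishes in positive degree by `hz`. Hence only the generators themselves occur.
    obtain ⟨t₀, ht₀, hmax⟩ := f.support.exists_max_image
      (fun t => ∑ i, t.1.2 i) ⟨t, ht⟩
    by_contra hne
    have h1 : 1 ≤ ∑ i, t₀.1.2 i := (Nat.one_le_iff_ne_zero.mpr hne).trans (hmax t ht)
    have h0 := leadCoeff_eq_zero_of_mem_lower h hz h1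
    rw [Finsupp.linearCombination_apply, Finsupp.sum, AddSubmonoidClass.coe_finsetSum,
      map_sum, Finsupp.finsetSum_apply, Finset.sum_eq_single t₀] at h0
    · rw [Submodule.coe_smul_of_tower, map_smul, Finsupp.smul_apply, Submodule.coe_smul,
        leadCoeff_stdMonomial_smul_syz h hg t₀ t₀ le_rfl, Finsupp.single_eq_same,
        smul_eq_mul, mul_one] at h0
      exact Finsupp.mem_support_iff.mp ht₀ h0
    · intro s hs hst
      rw [Submodule.coe_smul_of_tower, map_smul, Finsupp.smul_apply, Submodule.coe_smul,
        leadCoeff_stdMonomial_smul_syz h hg s t₀ (hmax s hs),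
        Finsupp.single_eq_of_ne hst.symm, smul_zero]
    · exact fun hn => (hn ht₀).elim
  rw [Finsupp.linearCombination_apply]
  refine sum_mem fun t ht => Submodule.smul_mem _ _ ?_
  have h0 : ∀ i, t.1.2 i = 0 := by simpa using hf t ht
  rw [stdMonomial_eq_one x h0, one_smul]
  exact Submodule.subset_span ⟨_, rfl⟩

/-- Modulo lower terms, `x_k x_i e_b` is a combination of the `x_i h`. -/
theorem var_smul_var_smul_single_mem (h : IsLeftPBW R x) (hg : IsLeveledBasis R x l g)
    {b : B} {i k : Fin n} (hb : l b ≤ k) (hik : i < k) :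
    x k • x i • Finsupp.single b (1 : A) ∈ Submodule.span R
      {y : B →₀ A | ∃ (i : Fin n) (b' : SyzIdx n l), i < k ∧ syzLevel n l b' = k + 1 ∧
        y = x i • (hg.syz b' : B →₀ A)} ⊔ lower R x l 1 (k + 1) := by
  obtain ⟨c, a, d, hc⟩ := h.comm i k
  have hlow : ∀ m : Fin n, x m • Finsupp.single b (1 : A) ∈ lower R x l 1 (k + 1) := by
    intro m
    rw [Finsupp.smul_single, smul_eq_mul, mul_one]
    exact single_mem_lower (Or.inl (IsLeftPBW.var_mem_filt m.2))
  rw [smul_smul, hc, add_smul, add_smul, Finset.sum_smul]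
  simp only [smul_assoc, mul_smul, one_smul]
  refine add_mem (add_mem (Submodule.smul_mem _ _ ?_) (Submodule.mem_sup_right
    (sum_mem fun m _ => Submodule.smul_mem _ _ (hlow m))))
    (Submodule.mem_sup_right (Submodule.smul_mem _ _
      (single_mem_lower (Or.inl (IsLeftPBW.one_mem_filt _ _)))))
  -- After the exchange, `x k e_b` is replaced by generator plus tail. Multiplying by `x i` with `i
  -- < k` gives an allowed product and keeps the tail in `lower`.
  have hs : x k • Finsupp.single b (1 : A) =
      (hg.syz ⟨b, k, hb⟩ : B →₀ A) + hg.tail ⟨b, k, hb⟩ := by simp [syz]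
  rw [hs, smul_add]
  exact add_mem (Submodule.mem_sup_left (Submodule.subset_span ⟨i, ⟨b, k, hb⟩, hik, rfl, rfl⟩))
    (Submodule.mem_sup_right (var_smul_mem_lower h ((Fin.lt_def.mp hik).trans
      (Nat.lt_succ_self _)) (hg.tail_mem_lower ⟨b, k, hb⟩)))

/-- The kernel of the presentation given by a leveled basis has a leveled basis, with larger
levels. -/
theorem isLeveledBasis_syz (h : IsLeftPBW R x) (hg : IsLeveledBasis R x l g) :
    IsLeveledBasis R x (syzLevel n l) hg.syz where
  bijective := syz_bijective h hg
  smul_mem := by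
    rintro ⟨b, j, hj⟩ k hjk
    replace hjk : j < k := Fin.lt_def.mpr hjk
    set Y : Submodule R (B →₀ A) := Submodule.span R {y : B →₀ A | ∃ (i : Fin n)
      (b' : SyzIdx n l), i < k ∧ syzLevel n l b' = k + 1 ∧ y = x i • (hg.syz b' : B →₀ A)}
      with hY
    have hmem : x k • (hg.syz ⟨b, j, hj⟩ : B →₀ A) ∈ Y ⊔ lower R x l 1 (k + 1) := by
      rw [syz, smul_sub]
      refine sub_mem (var_smul_var_smul_single_mem h hg (hj.trans hjk.le) hjk) ?_
      refine h.smul_mem_of_mem_span ?_ ?_ (hg.tail_mem_span ⟨b, j, hj⟩)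
      · rintro _ (⟨i, b', hi, hb', rfl⟩ | ⟨b', rfl⟩)
        · refine Submodule.mem_sup_right ?_
          rw [Finsupp.smul_single, smul_eq_mul, mul_one]
          exact single_mem_lower (Or.inl (IsLeftPBW.var_mem_filt i.2))
        · exact Submodule.mem_sup_right
            (single_mem_lower (Or.inl (IsLeftPBW.one_mem_filt _ _)))
      · rintro _ (⟨i, b', hi, hb', rfl⟩ | ⟨b', rfl⟩)
        · exact var_smul_var_smul_single_mem h hg (hb'.trans_le hjk) (hi.trans hjk)
        · refine Submodule.mem_sup_right ?_
          simp only [Finsupp.smul_single, smul_eq_mul, mul_one]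
          exact single_mem_lower (Or.inl (IsLeftPBW.var_mem_filt k.2))
    obtain ⟨y, hy, v, hv, hyv⟩ := Submodule.mem_sup.mp hmem
    have hYmap : Y = Submodule.map ((LinearMap.ker (pres A g)).subtype.restrictScalars R)
        (Submodule.span R {y | ∃ (i : Fin n) (b' : SyzIdx n l), i < k ∧
          syzLevel n l b' = k + 1 ∧ y = x i • hg.syz b'}) := by
      rw [hY, Submodule.map_span]
      congr 1
      ext y
      constructor
      · rintro ⟨i, b', hi, hb', rfl⟩
        exact ⟨_, ⟨i, b', hi, hb', rfl⟩, rfl⟩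
      · rintro ⟨_, ⟨i, b', hi, hb', rfl⟩, rfl⟩
        exact ⟨i, b', hi, hb', rfl⟩
    rw [hYmap] at hy
    obtain ⟨y', hy', rfl⟩ := hy
    -- The remainder `v` is a difference of kernel elements, so it is an `R`-combination of the
    -- generators.
    have hv' : v = ((x k • hg.syz ⟨b, j, hj⟩ - y' : LinearMap.ker (pres A g)) : B →₀ A) := by
      rw [Submodule.coe_sub, Submodule.coe_smul, ← hyv]
      simp
    rw [hv'] at hv
    have := mem_span_syz_of_mem_lower h hg _ hv
    rw [← sub_add_cancel (x k • hg.syz ⟨b, j, hj⟩) y']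
    exact add_mem (Submodule.span_mono Set.subset_union_right this)
      (Submodule.span_mono Set.subset_union_left hy')

end IsLeveledBasis

namespace IsLeveledBasis

variable {R A N B : Type*} [Ring R] [Ring A] [Module R A] {n : ℕ} {x : Fin n → A}
  [AddCommGroup N] [Module R N] [Module A N] {l : B → ℕ} {g : B → N}

/-- A basis over `R` is a leveled basis of level zero. -/
theorem of_basis (b : Module.Basis B R N) : IsLeveledBasis R x (fun _ => 0) b where
  bijective := by
    let e : B ≃ {t : Σ _ : B, Fin n → ℕ // SuppLT 0 t.2} :=
      { toFun := fun i => ⟨⟨i, 0⟩, suppLT_zero 0⟩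
        invFun := fun t => t.1.1
        left_inv := fun _ => rfl
        right_inv := by
          rintro ⟨⟨i, α⟩, hα⟩
          obtain rfl : α = 0 := by
            funext j
            by_contra hj
            exact absurd (hα j hj) (Nat.not_lt_zero _)
          rfl }
    have he : (fun t : {t : Σ _ : B, Fin n → ℕ // SuppLT 0 t.2} =>
        stdMonomial x t.1.2 • b t.1.1) = b.reindex e := by
      funext t
      obtain ⟨i, rfl⟩ := e.surjective t
      rw [Module.Basis.reindex_apply, Equiv.symm_apply_apply]
      simp [e, IsSkewPBW.stdMonomial_zero]
    rw [he, ← Module.Basis.coe_repr_symm]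
    exact (b.reindex e).repr.symm.bijective
  smul_mem := fun i j _ =>
    Submodule.span_mono Set.subset_union_right (by rw [b.span_eq]; trivial)

variable [IsScalarTower R A N]

theorem pres_surjective (hg : IsLeveledBasis R x l g) : Function.Surjective (pres A g) := by
  intro y
  obtain ⟨f, rfl⟩ := hg.bijective.2 y
  rw [Finsupp.linearCombination_apply]
  change _ ∈ LinearMap.range ((pres A g).restrictScalars R)
  exact sum_mem fun t _ => Submodule.smul_mem _ _ ⟨Finsupp.single t.1.1 (stdMonomial x t.1.2),
    by simp⟩

/-- A leveled basis in which all variables are allowed is a basis. -/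
theorem pres_bijective (h : IsLeftPBW R x) (hg : IsLeveledBasis R x l g) (hl : ∀ b, n ≤ l b) :
    Function.Bijective (pres A g) := by
  refine ⟨(injective_iff_map_eq_zero _).mpr fun z hz => ?_, hg.pres_surjective⟩
  refine eq_zero_of_leadCoeff_eq_zero h hg hz (Finsupp.ext fun t => ?_)
  exact absurd ((hl t.1.1.1).trans t.1.1.2.2) (not_le.mpr t.1.1.2.1.2)

end IsLeveledBasis

/-! ### Projective and global dimension -/

theorem moduleCat_shortExact_of_ker {A : Type u} [Ring A] {F N : Type u} [AddCommGroup F]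
    [Module A F] [AddCommGroup N] [Module A N] (p : F →ₗ[A] N) (hp : Function.Surjective p) :
    ∃ S : ShortComplex (ModuleCat.{u} A), S.ShortExact ∧
      S.X₁ = ModuleCat.of A (LinearMap.ker p) ∧ S.X₂ = ModuleCat.of A F ∧
      S.X₃ = ModuleCat.of A N := by
  have hz : ModuleCat.ofHom (LinearMap.ker p).subtype ≫ ModuleCat.ofHom p = 0 := by
    ext z
    simp
  refine ⟨ShortComplex.mk _ _ hz, ?_, rfl, rfl, rfl⟩
  refine { exact := ?_, mono_f := ?_, epi_g := ?_ }
  · rw [ShortComplex.ShortExact.moduleCat_exact_iff_function_exact]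
    exact LinearMap.exact_subtype_ker_map p
  · rw [ModuleCat.mono_iff_injective]
    exact Subtype.val_injective
  · rw [ModuleCat.epi_iff_surjective]
    exact hp

theorem hasProjectiveDimensionLT_succ_iff_ker {A : Type u} [Ring A] {F N : Type u}
    [AddCommGroup F] [Module A F] [AddCommGroup N] [Module A N] (p : F →ₗ[A] N)
    (hp : Function.Surjective p) [Module.Projective A F] (k : ℕ) :
    HasProjectiveDimensionLT (ModuleCat.of A N) (k + 2) ↔
      HasProjectiveDimensionLT (ModuleCat.of A (LinearMap.ker p)) (k + 1) := by
  obtain ⟨S, hS, h1, h2, h3⟩ := moduleCat_shortExact_of_ker p hp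
  rw [← h1, ← h3]
  refine hS.hasProjectiveDimensionLT_X₃_iff k ?_
  rw [h2]
  exact (IsProjective.iff_projective F).mp ‹_›

section ProjectiveDimension

variable {R A : Type u} [Ring R] [Ring A] [Module R A] [IsScalarTower R A A] {n : ℕ}
  {x : Fin n → A}

theorem IsLeveledBasis.hasProjectiveDimensionLT (h : IsLeftPBW R x) (k : ℕ) {N B : Type u}
    [AddCommGroup N] [Module R N] [Module A N] [IsScalarTower R A N] {l : B → ℕ} {g : B → N}
    (hg : IsLeveledBasis R x l g) (hl : ∀ b, n ≤ l b + k) :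
    HasProjectiveDimensionLT (ModuleCat.of A N) (k + 1) := by
  induction k generalizing N B with
  | zero =>
    have : Module.Projective A N :=
      .of_equiv (LinearEquiv.ofBijective _ (hg.pres_bijective h hl))
    have : Projective (ModuleCat.of A N) := (IsProjective.iff_projective N).mp this
    infer_instance
  | succ k ih =>
    rw [hasProjectiveDimensionLT_succ_iff_ker (pres A g) hg.pres_surjective]
    -- The new level `j + 1` exceeds the old one because `l b ≤ j`.
    refine ih (isLeveledBasis_syz h hg) fun b => ?_
    have := hl b.1
    have := b.2.2
    simp only [syzLevel]
    omega

/-- An Eilenberg swindle: a projective quotient of a free module `G` becomes free after adding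
countably many copies of `G`. -/
theorem free_prod_finsupp_of_projective {R M G : Type*} [Ring R] [AddCommGroup M] [Module R M]
    [AddCommGroup G] [Module R G] [Module.Projective R M] [Module.Free R G] (p : G →ₗ[R] M)
    (hp : Function.Surjective p) : Module.Free R (M × (ℕ →₀ G)) := by
  obtain ⟨s, hs⟩ := Module.projective_lifting_property p LinearMap.id hp
  let Q := LinearMap.ker p
  have hps : ∀ m, p (s m) = m := fun m => LinearMap.congr_fun hs m
  let e : G ≃ₗ[R] M × Q := LinearEquiv.ofLinearMap
    (p.prod (LinearMap.codRestrict Q (LinearMap.id - s.comp p) fun g => by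
      simp [Q, hps]))
    (s.coprod Q.subtype)
    (by
      ext m
      · simp [hps]
      · simp [hps]
      · simp
      · have : p m = 0 := m.2
        simp [this])
    (by ext g; simp)
  let prod : (ℕ →₀ M × Q) ≃ₗ[R] (ℕ →₀ M) × (ℕ →₀ Q) := LinearEquiv.ofLinearMap
    ((Finsupp.mapRange.linearMap (LinearMap.fst R M Q)).prod
      (Finsupp.mapRange.linearMap (LinearMap.snd R M Q)))
    ((Finsupp.mapRange.linearMap (LinearMap.inl R M Q)).coprod
      (Finsupp.mapRange.linearMap (LinearMap.inr R M Q)))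
    (by ext <;> simp)
    (by ext <;> simp)
  let shift : (M × (ℕ →₀ M)) ≃ₗ[R] (ℕ →₀ M) :=
    ((Finsupp.uniqueLinearEquiv R M ()).symm.prodCongr (LinearEquiv.refl R _)).trans
      ((Finsupp.sumFinsuppLEquivProdFinsupp R).symm.trans
        (Finsupp.domLCongr ((Equiv.sumComm Unit ℕ).trans Equiv.natSumPUnitEquivNat)))
  let eN : (ℕ →₀ G) ≃ₗ[R] (ℕ →₀ M) × (ℕ →₀ Q) := (Finsupp.mapRange.linearEquiv e).trans prod
  -- With `G ≅ M × Q`, the chain is `M × G^(ℕ) ≅ (M × M^(ℕ)) × Q^(ℕ) ≅ M^(ℕ) × Q^(ℕ) ≅ G^(ℕ)`.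
  exact Module.Free.of_equiv
    (((LinearEquiv.refl R M).prodCongr eN).trans
      ((LinearEquiv.prodAssoc R M (ℕ →₀ M) (ℕ →₀ Q)).symm.trans
        ((shift.prodCongr (LinearEquiv.refl R _)).trans eN.symm))).symm

/-- Free `A`-modules are `R`-free, so the swindle can be run with a free `A`-module covering `M`.
The resulting `R`-free module is an `A`-module with `M` as a direct summand over `A`. -/
theorem IsLeftPBW.hasProjectiveDimensionLT_of_projective (h : IsLeftPBW R x) (M : Type u)
    [AddCommGroup M] [Module R M] [Module A M] [IsScalarTower R A M] [Module.Projective R M] :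
    HasProjectiveDimensionLT (ModuleCat.of A M) (n + 1) := by
  have : Module.Free R A := Module.Free.of_basis h.basis
  have hp : Function.Surjective (Finsupp.linearCombination A (id : M → M)) :=
    Finsupp.linearCombination_id_surjective A M
  have hfree : Module.Free R (M × (ℕ →₀ M →₀ A)) :=
    free_prod_finsupp_of_projective
      ((Finsupp.linearCombination A (id : M → M)).restrictScalars R) hp
  have hpd : HasProjectiveDimensionLT (ModuleCat.of A (M × (ℕ →₀ M →₀ A))) (n + 1) :=
    (IsLeveledBasis.of_basis (x := x)
      (Module.Free.chooseBasis R (M × (ℕ →₀ M →₀ A)))).hasProjectiveDimensionLT h n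
      fun _ => Nat.le_add_left _ _
  have hr : Retract (ModuleCat.of A M) (ModuleCat.of A (M × (ℕ →₀ M →₀ A))) :=
    { i := ModuleCat.ofHom (LinearMap.inl A _ _)
      r := ModuleCat.ofHom (LinearMap.fst A _ _)
      retract := by
        ext m
        simp }
  exact hr.hasProjectiveDimensionLT (n + 1)

/-- A free `A`-presentation of `M` is also a free `R`-presentation, so passing to its kernel shifts
the dimension over both rings at once. -/
theorem IsLeftPBW.hasProjectiveDimensionLT (h : IsLeftPBW R x) (s : ℕ) (M : Type u)
    [AddCommGroup M] [Module R M] [Module A M] [IsScalarTower R A M]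
    (hM : HasProjectiveDimensionLT (ModuleCat.of R M) (s + 1)) :
    HasProjectiveDimensionLT (ModuleCat.of A M) (n + s + 1) := by
  induction s generalizing M with
  | zero =>
    have : Module.Projective R M := (IsProjective.iff_projective M).mpr
      (projective_iff_hasProjectiveDimensionLT_one.mpr hM)
    exact h.hasProjectiveDimensionLT_of_projective M
  | succ s ih =>
    have : Module.Free R A := Module.Free.of_basis h.basis
    have hp : Function.Surjective (Finsupp.linearCombination A (id : M → M)) :=
      Finsupp.linearCombination_id_surjective A M
    refine (hasProjectiveDimensionLT_succ_iff_ker _ hp (n + s)).mpr (ih _ ?_)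
    exact (hasProjectiveDimensionLT_succ_iff_ker
      ((Finsupp.linearCombination A (id : M → M)).restrictScalars R) hp s).mp hM

theorem IsLeftPBW.lgld_lt_top (h : IsLeftPBW R x) (hR : lgld R < ⊤) : lgld A < ⊤ := by
  obtain ⟨s, hs⟩ : ∃ s : ℕ, lgld R ≤ s := by
    generalize lgld R = d at hR
    induction d with
    | bot => exact ⟨0, bot_le⟩
    | coe d =>
      induction d with
      | top => exact absurd hR (lt_irrefl _)
      | coe d => exact ⟨d, le_rfl⟩
  refine lt_of_le_of_lt (b := ((n + s : ℕ) : WithBot ℕ∞)) (iSup_le fun M => ?_)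
    (WithBot.coe_lt_coe.mpr (ENat.natCast_lt_top _))
  let _ : Module R M := Module.compHom M (RingHom.smulOneHom : R →+* A)
  have : IsScalarTower R A M := ⟨fun r a m => by
    change (r • a) • m = (r • (1 : A)) • a • m
    rw [smul_smul, smul_mul_assoc, one_mul]⟩
  refine (projectiveDimension_le_iff M (n + s)).mpr (h.hasProjectiveDimensionLT s M ?_)
  exact (projectiveDimension_le_iff (ModuleCat.of R M) s).mp ((le_iSup _ _).trans hs)

end ProjectiveDimension

/-! ### Connected semi-graduations -/

section SemiGraded

variable {K B : Type*} [Field K] [Ring B] [Algebra K B]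

/-- The ring isomorphism `K ≃ B_0` for a connected semi-graduation. -/
noncomputable def IsConnectedSG.ringEquiv {𝓑 : ℕ → AddSubgroup B} (hc : IsConnectedSG K 𝓑)
    (h : IsSemiGraduation 𝓑) : K ≃+* h.zeroSubring :=
  RingEquiv.ofBijective
    ((algebraMap K B).codRestrict h.zeroSubring fun k => by
      change algebraMap K B k ∈ (𝓑 0 : Set B)
      rw [hc.2]
      exact ⟨k, rfl⟩)
    ⟨fun _ _ hab => hc.1 (congrArg Subtype.val hab), by
      rintro ⟨b, hb⟩
      change b ∈ (𝓑 0 : Set B) at hb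
      rw [hc.2] at hb
      obtain ⟨k, rfl⟩ := hb
      exact ⟨k, rfl⟩⟩

theorem IsConnectedSG.ringEquiv_coe {𝓑 : ℕ → AddSubgroup B} (hc : IsConnectedSG K 𝓑)
    (h : IsSemiGraduation 𝓑) (k : K) : (hc.ringEquiv h k : B) = algebraMap K B k := rfl

theorem IsConnectedSG.zeroSubring_smul {𝓑 : ℕ → AddSubgroup B} (hc : IsConnectedSG K 𝓑)
    (h : IsSemiGraduation 𝓑) (k : K) (b : B) : hc.ringEquiv h k • b = k • b := by
  rw [Subring.smul_def, hc.ringEquiv_coe, smul_eq_mul, Algebra.smul_def]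

attribute [local instance] RingHomInvPair.of_ringEquiv in
/-- A connected semi-graduation into finite-dimensional subspaces of a finitely generated algebra
is finite. -/
theorem IsConnectedSG.isFSG {𝓑 : ℕ → AddSubgroup B} (hc : IsConnectedSG K 𝓑)
    (h : IsSemiGraduation 𝓑) (hfd : ∀ p, ∃ W : Submodule K B, W.FG ∧ W.toAddSubgroup = 𝓑 p)
    (s : Finset B) (hs : Subring.closure (Set.range (algebraMap K B) ∪ (s : Set B)) = ⊤) :
    IsFSG 𝓑 where
  semi := h
  fg := ⟨s, by rw [hc.2, hs]⟩
  free := by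
    intro p
    obtain ⟨W, hW, hWp⟩ := hfd p
    let N : Submodule h.zeroSubring B :=
      { W.toAddSubgroup with
        smul_mem' := by
          intro c b hb
          obtain ⟨k, rfl⟩ := (hc.ringEquiv h).surjective c
          rw [hc.zeroSubring_smul]
          exact W.smul_mem k hb }
    let f : W ≃ₛₗ[RingHomClass.toRingHom (hc.ringEquiv h)] N :=
      { toFun := fun w => w
        invFun := fun w => w
        map_add' := fun _ _ => rfl
        map_smul' := fun k w => Subtype.ext (hc.zeroSubring_smul h k w).symm
        left_inv := fun _ => rfl
        right_inv := fun _ => rfl }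
    have : Module.Finite K W := Module.Finite.iff_fg.mpr hW
    exact ⟨N, hWp, Module.Free.of_equiv f, Module.Finite.of_surjective f.toLinearMap f.surjective⟩

/-- The components of a connected finitely semi-graded algebra are finite-dimensional. -/
theorem IsFSG.exists_fg_submodule {𝓑 : ℕ → AddSubgroup B} (hB : IsFSG 𝓑)
    (hc : IsConnectedSG K 𝓑) (p : ℕ) :
    ∃ W : Submodule K B, W.FG ∧ W.toAddSubgroup = 𝓑 p := by
  obtain ⟨N, hN, -, hfin⟩ := hB.free p
  let W : Submodule K B :=
    { N.toAddSubgroup with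
      smul_mem' := fun k b hb => by
        rw [← hc.zeroSubring_smul hB.semi]
        exact N.smul_mem _ hb }
  refine ⟨W, ?_, hN⟩
  obtain ⟨s, hs⟩ := Module.Finite.iff_fg.mp hfin
  refine ⟨s, le_antisymm (Submodule.span_le.mpr fun b hb => ?_) fun b hb => ?_⟩
  · change b ∈ N
    rw [← hs]
    exact Submodule.subset_span hb
  · change b ∈ N at hb
    rw [← hs] at hb
    induction hb using Submodule.span_induction with
    | mem b hb => exact Submodule.subset_span hb
    | zero => exact zero_mem _
    | add _ _ _ _ ha hb => exact add_mem ha hb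
    | smul c b _ hb =>
      obtain ⟨k, rfl⟩ := (hc.ringEquiv hB.semi).surjective c
      rw [hc.zeroSubring_smul]
      exact Submodule.smul_mem _ k hb

/-- Successive complements in the filtration by the powers of a subspace. -/
theorem exists_complements (V U : Submodule K B) (h1 : 1 ≤ V) (hU : U ≤ V)
    (hd : Disjoint U 1) : ∃ W : ℕ → Submodule K B, W 0 = 1 ∧ U ≤ W 1 ∧
      ∀ p, Disjoint (W (p + 1)) (V ^ p) ∧ W (p + 1) ⊔ V ^ p = V ^ (p + 1) := by
  have key : ∀ p, ∃ C : Submodule K B, (if p = 0 then U else ⊥) ≤ C ∧ IsCompl C (V ^ p) := by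
    intro p
    refine Disjoint.exists_isCompl ?_
    split_ifs with hp
    · rwa [hp, pow_zero]
    · exact disjoint_bot_left
  choose C hUC hC using key
  -- By the modular law, intersecting a complement of `V^p` in `B` with `V^(p+1)` gives a complement
  -- inside `V^(p+1)`.
  refine ⟨fun p => Nat.casesOn p 1 fun p => C p ⊓ V ^ (p + 1), rfl, ?_, fun p => ⟨?_, ?_⟩⟩
  · exact le_inf (by simpa using hUC 0) (by simpa using hU)
  · exact (hC p).disjoint.mono_left inf_le_left
  · have hle : V ^ p ≤ V ^ (p + 1) := pow_le_pow_right₀ h1 (Nat.le_succ p)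
    rw [sup_comm, ← sup_inf_assoc_of_le _ hle, sup_comm, (hC p).sup_eq_top, top_inf_eq]

/-- The filtration by the powers of a generating subspace comes from a semi-graduation. -/
theorem exists_isSemiGraduation (V U : Submodule K B) (hV : V.FG) (h1 : 1 ≤ V) (hU : U ≤ V)
    (hd : Disjoint U 1) (htop : ∀ b, ∃ p, b ∈ V ^ p) : ∃ W : ℕ → Submodule K B,
      W 0 = 1 ∧ U ≤ W 1 ∧ (∀ p, (W p).FG) ∧ IsSemiGraduation fun p => (W p).toAddSubgroup := by
  obtain ⟨W, hW0, hUW, hW⟩ := exists_complements V U h1 hU hd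
  have hle : ∀ p, W p ≤ V ^ p := by
    rintro (_ | p)
    · rw [hW0, pow_zero]
    · exact le_sup_left.trans (hW p).2.le
  have hmono : Monotone fun p => V ^ p := fun _ _ h => pow_le_pow_right₀ h1 h
  have hmem : ∀ p, ∀ z ∈ V ^ p, z ∈ ⨆ k ∈ Set.Iic p, (W k).toAddSubgroup := by
    intro p
    induction p with
    | zero =>
      intro z hz
      rw [pow_zero, ← hW0] at hz
      exact le_biSup (fun k => (W k).toAddSubgroup) (Set.mem_Iic.mpr le_rfl) hz
    | succ p ih =>
      intro z hz
      rw [← (hW p).2] at hz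
      obtain ⟨w, hw, v, hv, rfl⟩ := Submodule.mem_sup.mp hz
      refine add_mem (le_biSup (fun k => (W k).toAddSubgroup) (Set.mem_Iic.mpr le_rfl) hw) ?_
      have hsub : ⨆ k ∈ Set.Iic p, (W k).toAddSubgroup ≤
          ⨆ k ∈ Set.Iic (p + 1), (W k).toAddSubgroup :=
        biSup_mono fun k hk => Set.mem_Iic.mpr ((Set.mem_Iic.mp hk).trans (Nat.le_succ p))
      exact hsub (ih v hv)
  have hindep : iSupIndep W := by
    classical
    rw [iSupIndep_iff_finsetSum_eq_zero_imp_eq_zero]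
    intro s v hv hsum
    by_contra! hne
    obtain ⟨i, hi, hvi⟩ := hne
    let t := s.filter fun i => v i ≠ 0
    have ht : t.Nonempty := ⟨i, by simp [t, hi, hvi]⟩
    obtain ⟨hm, hvm⟩ : t.max' ht ∈ s ∧ v (t.max' ht) ≠ 0 := by
      simpa [t] using t.max'_mem ht
    set m := t.max' ht
    -- The top nonzero component is minus the sum of the lower ones, so for `m = p + 1` it lies in
    -- `V^p`, which meets `W (p + 1)` trivially.
    have hsm : v m = -∑ k ∈ s.erase m, v k := by
      rw [eq_neg_iff_add_eq_zero, Finset.add_sum_erase s v hm, hsum]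
    have hlow : ∀ k ∈ s.erase m, v k ≠ 0 → k < m := fun k hk hvk =>
      lt_of_le_of_ne (t.le_max' k (by simp [t, Finset.mem_of_mem_erase hk, hvk]))
        (Finset.ne_of_mem_erase hk)
    rcases hmm : m with _ | p
    · refine hvm ?_
      rw [hsm, neg_eq_zero]
      refine Finset.sum_eq_zero fun k hk => ?_
      by_contra hvk
      have := hlow k hk hvk
      omega
    · refine hvm ((Submodule.disjoint_def.mp (hW p).1) _ (hmm ▸ hv m hm) ?_)
      rw [hsm]
      refine neg_mem (sum_mem fun k hk => ?_)
      by_cases hvk : v k = 0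
      · rw [hvk]
        exact zero_mem _
      · have hkp : k ≤ p := by
          have := hlow k hk hvk
          omega
        exact hmono hkp (hle k (hv k (Finset.mem_of_mem_erase hk)))
  have hsup : iSup W = ⊤ := by
    rw [eq_top_iff]
    intro z _
    obtain ⟨p, hp⟩ := htop z
    have hsub : ⨆ k ∈ Set.Iic p, (W k).toAddSubgroup ≤ (iSup W).toAddSubgroup :=
      iSup₂_le fun k _ => le_iSup W k
    exact hsub (hmem p z hp)
  refine ⟨W, hW0, hUW, fun p => (hV.pow p).of_le (hle p), ?_, ?_, ?_⟩
  · exact DirectSum.isInternal_submodule_of_iSupIndep_of_iSup_eq_top hindep hsup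
  · intro m n a ha b hb
    have hab : a * b ∈ V ^ (m + n) := by
      rw [pow_add]
      exact Submodule.mul_mem_mul (hle m ha) (hle n hb)
    exact hmem _ _ hab
  · change (1 : B) ∈ W 0
    rw [hW0]
    exact Submodule.one_le.mp le_rfl

/-- A finitely generated algebra has a finite connected semi-graduation. -/
theorem exists_isFSG (hinj : Function.Injective (algebraMap K B)) (s : Finset B)
    (hs : Subring.closure (Set.range (algebraMap K B) ∪ (s : Set B)) = ⊤)
    (U : Submodule K B) (hU : U.FG) (hd : Disjoint U 1) :
    ∃ 𝓑 : ℕ → AddSubgroup B, IsFSG 𝓑 ∧ IsConnectedSG K 𝓑 ∧ ∀ u ∈ U, u ∈ 𝓑 1 := by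
  let V : Submodule K B := 1 ⊔ U ⊔ Submodule.span K s
  have h1 : 1 ≤ V := le_sup_left.trans le_sup_left
  have hV : V.FG := ((Submodule.one_eq_span (R := K) (A := B) ▸ Submodule.fg_span_singleton 1 :
    (1 : Submodule K B).FG).sup hU).sup (Submodule.fg_span s.finite_toSet)
  have htop : ∀ b, ∃ p, b ∈ V ^ p := by
    have hmono : Monotone fun p => V ^ p := fun _ _ h => pow_le_pow_right₀ h1 h
    intro b
    have hb : b ∈ Subring.closure (Set.range (algebraMap K B) ∪ (s : Set B)) := by
      rw [hs]
      trivial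
    induction hb using Subring.closure_induction with
    | mem b hb =>
      rcases hb with ⟨k, rfl⟩ | hb
      · exact ⟨0, by rw [pow_zero]; exact Submodule.mem_one.mpr ⟨k, rfl⟩⟩
      · exact ⟨1, by rw [pow_one]; exact Submodule.mem_sup_right (Submodule.subset_span hb)⟩
    | zero => exact ⟨0, zero_mem _⟩
    | one => exact ⟨0, by rw [pow_zero]; exact Submodule.one_le.mp le_rfl⟩
    | add a b _ _ ha hb =>
      obtain ⟨p, hp⟩ := ha
      obtain ⟨q, hq⟩ := hb
      exact ⟨max p q, add_mem (hmono (le_max_left p q) hp) (hmono (le_max_right p q) hq)⟩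
    | neg a _ ha => exact ha.imp fun _ => neg_mem
    | mul a b _ _ ha hb =>
      obtain ⟨p, hp⟩ := ha
      obtain ⟨q, hq⟩ := hb
      exact ⟨p + q, by rw [pow_add]; exact Submodule.mul_mem_mul hp hq⟩
  obtain ⟨W, hW0, hUW, hWfg, hsemi⟩ :=
    exists_isSemiGraduation V U hV h1 (le_sup_right.trans le_sup_left) hd htop
  have hc : IsConnectedSG K fun p => (W p).toAddSubgroup := by
    refine ⟨hinj, Set.ext fun b => ?_⟩
    change b ∈ W 0 ↔ _
    rw [hW0]
    exact Submodule.mem_one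
  exact ⟨_, hc.isFSG hsemi (fun p => ⟨W p, hWfg p, rfl⟩) s hs, hc, fun u hu => hUW hu⟩

end SemiGraded

/-! ### Regularity in the case of a unit in `B_{≥1}` -/

/-- If `B_{≥ 1} = B`, then Artin-Schelter regularity only asks for finite left global dimension
besides the conditions on the semi-graduation. -/
theorem isSASWith_of_one_mem_geIdeal {K : Type*} {B : Type u} [Field K] [Ring B] [Algebra K B]
    {𝓑 : ℕ → AddSubgroup B} (hB : IsFSG 𝓑) (hc : IsConnectedSG K 𝓑) (hlt : lgld B < ⊤)
    (h1 : (1 : B) ∈ geIdeal 𝓑 1) : IsSASWith K B 𝓑 := by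
  have : Nontrivial B := hc.1.nontrivial
  have hq : Subsingleton (B ⧸ (geIdeal 𝓑 1).asIdeal) := by
    rw [Submodule.Quotient.subsingleton_iff, Ideal.eq_top_iff_one]
    exact TwoSidedIdeal.mem_asIdeal.mpr h1
  have hext : ∀ i, Subsingleton (Abelian.Ext.{u}
      (ModuleCat.of B (B ⧸ (geIdeal 𝓑 1).asIdeal)) (ModuleCat.of B B) i) := by
    intro i
    have := (ModuleCat.isZero_of_subsingleton
      (ModuleCat.of B (B ⧸ (geIdeal 𝓑 1).asIdeal))).hasProjectiveDimensionLT_zero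
    exact HasProjectiveDimensionLT.subsingleton _ 0 i (Nat.zero_le i) _
  obtain ⟨d, hd⟩ : ∃ d : ℕ, lgld B = ((d : ℕ∞) : WithBot ℕ∞) := by
    -- The value `⊥` would mean that every module is zero, but `B` itself is not.
    have hbot : lgld B ≠ ⊥ := by
      intro hb
      have h0 : projectiveDimension (ModuleCat.of B B) = ⊥ :=
        le_bot_iff.mp (hb ▸ le_iSup (fun M : ModuleCat.{u} B => projectiveDimension M) _)
      rw [projectiveDimension_eq_bot_iff, ModuleCat.isZero_of_iff_subsingleton] at h0
      exact not_subsingleton B h0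
    generalize lgld B = e at hlt hbot
    induction e with
    | bot => exact absurd rfl hbot
    | coe e =>
      induction e with
      | top => exact absurd hlt (lt_irrefl _)
      | coe e => exact ⟨e, rfl⟩
  refine ⟨hB, hc, d, hd, fun i _ => hext i, ?_⟩
  have := hext d
  exact ⟨{ toFun := 0, invFun := 0, left_inv := fun _ => Subsingleton.elim _ _,
           right_inv := fun _ => Subsingleton.elim _ _,
           map_add' := fun _ _ => Subsingleton.elim _ _ }, fun _ _ => Subsingleton.elim _ _⟩

/-! ### Application to skew PBW extensions -/

namespace IsSkewPBW

variable {R A : Type*} [Ring R] [Ring A] {ι : R →+* A} {n : ℕ} {x : Fin n → A}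

theorem mem_of_forall_mul_stdMonomial_mem (h : IsSkewPBW ι x) {S : AddSubgroup A}
    (hS : ∀ r α, ι r * stdMonomial x α ∈ S) (z : A) : z ∈ S := by
  obtain ⟨f, rfl, -⟩ := h.free z
  exact sum_mem fun α _ => hS _ _

theorem stdMonomial_mem_subring (S : Subring A) (hx : ∀ i, x i ∈ S) (α : Fin n → ℕ) :
    stdMonomial x α ∈ S := by
  refine list_prod_mem fun a ha => ?_
  obtain ⟨i, rfl⟩ := (List.mem_ofFn' _ _).mp ha
  exact pow_mem (hx i) _

theorem isLeftPBW (h : IsSkewPBW ι x) :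
    let _ : Module R A := Module.compHom A ι
    IsLeftPBW R x := by
  let _ : Module R A := Module.compHom A ι
  have hsmul : ∀ (r : R) (a : A), r • a = ι r * a := fun _ _ => rfl
  have hlc : ∀ f : (Fin n → ℕ) →₀ R, Finsupp.linearCombination R (stdMonomial x) f =
      f.sum fun α r => ι r * stdMonomial x α := fun _ => rfl
  refine ⟨?_, ?_, ?_, ?_⟩
  · intro f g hfg
    rw [hlc, hlc] at hfg
    exact (h.free _).unique hfg rfl
  · rw [eq_top_iff]
    intro z _
    exact h.mem_of_forall_mul_stdMonomial_mem
      (S := (Submodule.span R (Set.range (stdMonomial x))).toAddSubgroup)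
      (fun r α => Submodule.smul_mem _ r (Submodule.subset_span ⟨α, rfl⟩)) z
  · intro i r
    refine ⟨h.sigma i r, h.delta i r, ?_⟩
    simp only [hsmul, mul_one]
    exact h.mul_eq i r
  · intro i j
    obtain ⟨c, -, a, d, hc⟩ := h.comm_var i j
    refine ⟨c, a, d, ?_⟩
    simp only [hsmul, mul_one, ← mul_assoc]
    exact hc

/-- A skew PBW extension of a ring of finite left global dimension has finite left global
dimension. -/
theorem lgld_lt_top {R A : Type u} [Ring R] [Ring A] {ι : R →+* A} {n : ℕ} {x : Fin n → A}
    (h : IsSkewPBW ι x) (hR : lgld R < ⊤) : lgld A < ⊤ := by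
  let _ : Module R A := Module.compHom A ι
  have : IsScalarTower R A A := ⟨fun r a b => mul_assoc (ι r) a b⟩
  exact h.isLeftPBW.lgld_lt_top hR

end IsSkewPBW

section Algebra

variable {K R A : Type*} [Field K] [Ring R] [Ring A] [Algebra K R] [Algebra K A] {ι : R →ₐ[K] A}
  {n : ℕ} {x : Fin n → A}

/-- The coefficient at the exponent zero vanishes on the span of the variables and determines a
scalar. This is what allows the variables to be placed in degree one. -/
theorem IsSkewPBW.disjoint_span_one (h : IsSkewPBW (ι : R →+* A) x) :
    Disjoint (Submodule.span K (Set.range x)) (1 : Submodule K A) := by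
  let _ : Module R A := Module.compHom A (ι : R →+* A)
  have hL : IsLeftPBW R x := h.isLeftPBW
  have hsmul : ∀ (r : R) (a : A), r • a = ι r * a := fun _ _ => rfl
  have hK : ∀ (k : K) (a : A), k • a = algebraMap K R k • a := fun k a => by
    rw [hsmul, AlgHom.commutes, Algebra.smul_def]
  rw [Submodule.disjoint_def]
  intro z hz h1
  have h0 : hL.basis.repr z 0 = 0 := by
    clear h1
    induction hz using Submodule.span_induction with
    | mem z hz =>
      obtain ⟨i, rfl⟩ := hz
      have hi : x i = hL.basis (Pi.single i 1) := by
        rw [hL.basis_apply, IsSkewPBW.stdMonomial_single]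
      rw [hi, Module.Basis.repr_self, Finsupp.single_eq_of_ne]
      intro h0
      simpa using congrFun h0 i
    | zero => simp
    | add a b _ _ ha hb =>
      simp [ha, hb]
    | smul k a _ ha =>
      rw [hK, map_smul, Finsupp.smul_apply, ha, smul_zero]
  obtain ⟨k, rfl⟩ := Submodule.mem_one.mp h1
  have hk : algebraMap K A k = algebraMap K R k • hL.basis 0 := by
    rw [hL.basis_apply, IsSkewPBW.stdMonomial_zero, ← hK, Algebra.smul_def, mul_one]
  rw [hk, map_smul, Module.Basis.repr_self, Finsupp.smul_apply, Finsupp.single_eq_same,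
    smul_eq_mul, mul_one] at h0
  rw [hk, h0, zero_smul]

/-- A skew PBW extension of a finitely generated algebra is finitely generated. -/
theorem IsSkewPBW.exists_closure_eq_top (h : IsSkewPBW (ι : R →+* A) x) {s : Finset R}
    (hs : Subring.closure (Set.range (algebraMap K R) ∪ (s : Set R)) = ⊤) :
    ∃ t : Finset A, Subring.closure (Set.range (algebraMap K A) ∪ (t : Set A)) = ⊤ := by
  classical
  refine ⟨s.image ι ∪ Finset.univ.image x, ?_⟩
  set S := Subring.closure (Set.range (algebraMap K A) ∪
    ((s.image ι ∪ Finset.univ.image x : Finset A) : Set A)) with hS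
  have hR : ∀ r, ι r ∈ S := by
    have hle : Subring.closure (Set.range (algebraMap K R) ∪ (s : Set R)) ≤
        S.comap (ι : R →+* A) := by
      rw [Subring.closure_le]
      rintro _ (⟨k, rfl⟩ | hr)
      · exact Subring.subset_closure (Or.inl ⟨k, (ι.commutes k).symm⟩)
      · refine Subring.subset_closure (Or.inr ?_)
        simp only [Finset.coe_union, Finset.coe_image]
        exact Or.inl ⟨_, hr, rfl⟩
    rw [hs] at hle
    exact fun r => hle trivial
  have hx : ∀ i, x i ∈ S := fun i => Subring.subset_closure (Or.inr (by simp))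
  rw [eq_top_iff]
  intro z _
  exact h.mem_of_forall_mul_stdMonomial_mem (S := S.toAddSubgroup)
    (fun r α => S.mul_mem (hR r) (IsSkewPBW.stdMonomial_mem_subring S hx α)) z

/-- If some relation has a nonzero scalar constant term and all variables have degree one, then
`A_{≥ 1} = A`. -/
theorem CommRel.one_mem_geIdeal {i j : Fin n} {c : R} {a : Fin n → R} {d : K} (hd : d ≠ 0)
    (hr : CommRel (ι : R →+* A) x i j c a (algebraMap K R d)) {𝓑 : ℕ → AddSubgroup A}
    (hx : ∀ i, x i ∈ 𝓑 1) : (1 : A) ∈ geIdeal 𝓑 1 := by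
  rw [geIdeal, TwoSidedIdeal.mem_sInf]
  rintro I ⟨hI, -⟩
  have hxI : ∀ i, x i ∈ I := fun i => hI 1 le_rfl _ (hx i)
  have hdI : algebraMap K A d ∈ I := by
    -- Only left multiples of variables occur on the right-hand side.
    have he : algebraMap K A d = x j * x i - ι c * x i * x j - ∑ k, ι (a k) * x k := by
      rw [← ι.commutes d]
      have := hr
      simp only [CommRel, RingHom.coe_coe] at this
      rw [this]
      abel
    rw [he]
    exact sub_mem (sub_mem (I.mul_mem_left _ _ (hxI i)) (I.mul_mem_left _ _ (hxI j)))
      (sum_mem fun k _ => I.mul_mem_left _ _ (hxI k))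
  have := I.mul_mem_left (algebraMap K A d⁻¹) _ hdI
  rwa [← map_mul, inv_mul_cancel₀ hd, map_one] at this

theorem mem_canonicalFamily {𝓡 : ℕ → AddSubgroup R} {q p : ℕ} {r : R} (hr : r ∈ 𝓡 q)
    {α : Fin n → ℕ} (hp : q + ∑ i, α i = p) :
    ι r * stdMonomial x α ∈ canonicalFamily (ι : R →+* A) x 𝓡 p :=
  AddSubgroup.subset_closure ⟨q, r, α, hr, hp, rfl⟩

theorem var_mem_canonicalFamily {𝓡 : ℕ → AddSubgroup R} (h1 : (1 : R) ∈ 𝓡 0) (i : Fin n) :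
    x i ∈ canonicalFamily (ι : R →+* A) x 𝓡 1 := by
  have := mem_canonicalFamily (ι := ι) (x := x) h1 (α := Pi.single i 1) (p := 1) (by simp)
  rwa [map_one, one_mul, IsSkewPBW.stdMonomial_single] at this

theorem isConnectedSG_canonicalFamily (h : IsSkewPBW (ι : R →+* A) x) {𝓡 : ℕ → AddSubgroup R}
    (hc : IsConnectedSG K 𝓡) : IsConnectedSG K (canonicalFamily (ι : R →+* A) x 𝓡) := by
  have h0 : ∀ k, algebraMap K R k ∈ 𝓡 0 := fun k => by
    rw [← SetLike.mem_coe, hc.2]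
    exact ⟨k, rfl⟩
  refine ⟨?_, Set.Subset.antisymm ?_ ?_⟩
  · have := h.injective.comp hc.1
    intro a b hab
    refine this ?_
    simpa using hab
  · have hle : canonicalFamily (ι : R →+* A) x 𝓡 0 ≤ (algebraMap K A).range.toAddSubgroup := by
      rw [canonicalFamily, AddSubgroup.closure_le]
      rintro _ ⟨q, r, α, hr, hq, rfl⟩
      obtain ⟨rfl, hα⟩ := Nat.add_eq_zero_iff.mp hq
      rw [← SetLike.mem_coe, hc.2] at hr
      obtain ⟨k, rfl⟩ := hr
      rw [stdMonomial_eq_one x (by simpa using hα), mul_one]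
      exact ⟨k, (ι.commutes k).symm⟩
    exact hle
  · rintro _ ⟨k, rfl⟩
    have := mem_canonicalFamily (ι := ι) (x := x) (h0 k) (α := 0) (p := 0) (by simp)
    rwa [IsSkewPBW.stdMonomial_zero, mul_one, AlgHom.commutes] at this

theorem exists_fg_submodule_canonicalFamily {𝓡 : ℕ → AddSubgroup R}
    (hfd : ∀ q, ∃ W : Submodule K R, W.FG ∧ W.toAddSubgroup = 𝓡 q) (p : ℕ) :
    ∃ W : Submodule K A, W.FG ∧ W.toAddSubgroup = canonicalFamily (ι : R →+* A) x 𝓡 p := by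
  choose V hV hV𝓡 using hfd
  have hmem : ∀ q r, r ∈ V q ↔ r ∈ 𝓡 q := fun q r => by rw [← hV𝓡]; rfl
  let W : Submodule K A :=
    { canonicalFamily (ι : R →+* A) x 𝓡 p with
      smul_mem' := by
        intro k z hz
        change z ∈ canonicalFamily (ι : R →+* A) x 𝓡 p at hz
        change k • z ∈ canonicalFamily (ι : R →+* A) x 𝓡 p
        rw [canonicalFamily] at hz
        induction hz using AddSubgroup.closure_induction with
        | mem z hz =>
          obtain ⟨q, r, α, hr, hq, rfl⟩ := hz
          have := mem_canonicalFamily (ι := ι) (x := x)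
            ((hmem q _).mp ((V q).smul_mem k ((hmem q r).mpr hr))) hq
          rwa [map_smul, smul_mul_assoc] at this
        | zero => simp
        | add a b _ _ ha hb => rw [smul_add]; exact add_mem ha hb
        | neg a _ ha => rw [smul_neg]; exact neg_mem ha }
  refine ⟨W, ?_, rfl⟩
  let T : ℕ × (Fin n → ℕ) → Submodule K A := fun t =>
    (V t.1).map ((LinearMap.mulRight K (stdMonomial x t.2)).comp ι.toLinearMap)
  -- Since `q + |α| = p` bounds `q` and every `α i` by `p`, finitely many images of the
  -- finite-dimensional components of `R` cover the component of degree `p`.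
  let I : Finset (ℕ × (Fin n → ℕ)) := Finset.range (p + 1) ×ˢ Finset.Icc 0 (fun _ => p)
  have hT : (I.sup T).FG :=
    Submodule.fg_finset_sup I T fun t _ => (hV t.1).map _
  refine hT.of_le ?_
  have hle : canonicalFamily (ι : R →+* A) x 𝓡 p ≤ (I.sup T).toAddSubgroup := by
    rw [canonicalFamily, AddSubgroup.closure_le]
    rintro _ ⟨q, r, α, hr, hq, rfl⟩
    have hα : ∀ i, α i ≤ p := fun i =>
      (Finset.single_le_sum (f := α) (fun _ _ => Nat.zero_le _) (Finset.mem_univ i)).trans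
        (by omega)
    have ht : (q, α) ∈ I := by
      simp only [I, Finset.mem_product, Finset.mem_range, Finset.mem_Icc]
      exact ⟨by omega, fun _ => Nat.zero_le _, hα⟩
    exact Finset.le_sup (f := T) ht ⟨r, (hmem q r).mpr hr, rfl⟩
  exact hle

end Algebra

theorem theorem18p4p12 {K : Type*} {R A : Type u} [Field K] [Ring R] [Ring A]
    [Algebra K R] [Algebra K A] (ι : R →ₐ[K] A) {n : ℕ} (x : Fin n → A)
    (hA : IsSkewPBW (ι : R →+* A) x) (hbij : hA.IsBijective)
    (hlgld : lgld R < ⊤)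
    (𝓡 : ℕ → AddSubgroup R) (hFSG : IsFSG 𝓡) (hconn : IsConnectedSG K 𝓡)
    (hσ : ∀ i p, ∀ r ∈ 𝓡 p, hA.sigma i r ∈ 𝓡 p)
    (hδ : ∀ i p, ∀ r ∈ 𝓡 p, hA.delta i r ∈ 𝓡 p)
    (hd : ∃ (i j : Fin n) (c : R) (a : Fin n → R) (d : K), d ≠ 0 ∧
      CommRel (ι : R →+* A) x i j c a (algebraMap K R d)) :
    IsSAS K A ∧
      (IsSemiGraduation (canonicalFamily (ι : R →+* A) x 𝓡) →
        IsSASWith K A (canonicalFamily (ι : R →+* A) x 𝓡)) := by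
  obtain ⟨i, j, c, a, d, hd0, hrel⟩ := hd
  have hlt : lgld A < ⊤ := hA.lgld_lt_top hlgld
  have hc := isConnectedSG_canonicalFamily hA hconn
  obtain ⟨s, hs⟩ := hFSG.fg
  rw [hconn.2] at hs
  obtain ⟨t, ht⟩ := hA.exists_closure_eq_top hs
  refine ⟨?_, fun hsemi => ?_⟩
  -- The prescribed subspace of degree one is the `K`-span of the variables.
  · obtain ⟨𝓑, hB, hcB, hU⟩ := exists_isFSG hc.1 t ht _
      (Submodule.fg_span (Set.finite_range x)) hA.disjoint_span_one
    exact ⟨𝓑, isSASWith_of_one_mem_geIdeal hB hcB hlt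
      (hrel.one_mem_geIdeal hd0 fun i => hU _ (Submodule.subset_span ⟨i, rfl⟩))⟩
  · exact isSASWith_of_one_mem_geIdeal
      (hc.isFSG hsemi (exists_fg_submodule_canonicalFamily (hFSG.exists_fg_submodule hconn)) t ht) hc hlt
      (hrel.one_mem_geIdeal hd0 (var_mem_canonicalFamily hFSG.semi.one_mem))
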